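/- Let $\ell\ge 0$ be an integer, $g\in\mathbb{C}$, and for $\operatorname{Im}\tau>0$ put $\Lambda_\tau=\mathbb{Z}+\mathbb{Z}\tau$; let $\wp(u)=\wp(u\mid 1,\tau)$ be the Weierstrass function with primitive periods $1,\tau$. Let $$\theta_1(u\mid\tau)=-\sum_{n\in\mathbb{Z}}\exp\Bigl(\pi i\tau(n+\tfrac12)^2+2\pi i(n+\tfrac12)(u+\tfrac12)\Bigr),$$ $$x(u,z)=\frac{\theta_1(z-u)\,\theta_1'(0)}{\theta_1(z)\,\theta_1(u)},\qquad y(u,z)=\frac{\partial x(u,z)}{\partial u},$$ and let $$\mathcal H=\frac12\sum_{j=1}^{\ell}p_j^2+\frac{g^2}{2}\sum_{j\ne k}\wp(q_j-q_k)$$ be the Hamiltonian of the elliptic $A_{\ell-1}$ Calogero–Moser system, for $q,p\in\mathbb{C}^\ell$ with $q_j-q_k\notin\Lambda_\tau$ for all $j\ne k$. With the matrix units $E_{jk}$ define, for $z\notin\Lambda_\tau$, $$L(z)=\sum_{j}p_jE_{jj}+ig\sum_{j\ne k}x(q_j-q_k,z)E_{jk},$$ $$M(z)=\sum_{j}D_jE_{jj}+ig\sum_{j\ne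 k}y(q_j-q_k,z)E_{jk},\qquad D_j=ig\sum_{k\ne j}\wp(q_j-q_k).$$ (i) Let $(q(\tau),p(\tau))$, with $q_j(\tau)-q_k(\tau)\notin\Lambda_\tau$ for $j\ne k$, be a holomorphic solution, on an open set of $\tau$ in the upper half plane, of the non-autonomous Hamiltonian system $$2\pi i\frac{dq_j}{d\tau}=\frac{\partial\mathcal H}{\partial p_j}=p_j,\qquad 2\pi i\frac{dp_j}{d\tau}=-\frac{\partial\mathcal H}{\partial q_j}.$$ Then, at every $\tau$ in this set and every $z\notin\Lambda_\tau$, $L(z)$ is differentiable in $\tau$ along the solution (with $z$ fixed), $M(z)$ is differentiable in $z$, and $$2\pi i\frac{\partial L(z)}{\partial\tau}+\frac{\partial M(z)}{\partial z}=[L(z),M(z)].$$ (ii) For every $\tau$ in the upper half plane, all $q,p\in\mathbb{C}^\ell$ with $q_j-q_k\notin\Lambda_\tau$ for $j\ne k$, and all $z\notin\Lambda_\tau$, with $Q=\sum_jq_jE_{jj}$ and $P=\sum_jp_jE_{jj}$, $$L(z+1)=L(z),\qquad M(z+1)=M(z),$$ $$L(z+\tau)=e^{2\pi iQ}L(z)e^{-2\pi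 iQ},\qquad M(z+\tau)=e^{2\pi iQ}\bigl(M(z)+2\pi iL(z)\bigr)e^{-2\pi iQ}-2\pi iP.$$ -/

import Mathlib

open scoped UpperHalfPlane

noncomputable section

namespace EllipticCM

/-- The primitive periods `1` and `τ`, for `τ` in the upper half plane. -/
def periods (τ : ℍ) : PeriodPair where
  ω₁ := 1
  ω₂ := τ
  indep := by
    rw [LinearIndependent.pair_iff]
    intro s t h
    have h1 := congrArg Complex.im h
    have h2 := congrArg Complex.re h
    have ht : t = 0 := by
      have : τ.im ≠ 0 := τ.im_ne_zero
      simpa [this] using h1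
    subst ht
    simpa using h2

/-- The Weierstrass function `℘(u)` with primitive periods `1` and `τ`. -/
def wp (τ : ℍ) (u : ℂ) : ℂ := (periods τ).weierstrassP u

/-- The lattice `ℤ + ℤ τ`. -/
def Lambda (τ : ℍ) : Set ℂ := (periods τ).lattice

/-- Jacobi's theta function `θ₁(u | τ)`. -/
def theta1 (τ u : ℂ) : ℂ :=
  -∑' n : ℤ, Complex.exp
    (Real.pi * Complex.I * τ * ((n : ℂ) + 1 / 2) ^ 2 +
      2 * Real.pi * Complex.I * ((n : ℂ) + 1 / 2) * (u + 1 / 2))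

/-- The kernel `x(u, z) = θ₁(z - u) θ₁'(0) / (θ₁(z) θ₁(u))`. -/
def x (τ u z : ℂ) : ℂ :=
  theta1 τ (z - u) * deriv (theta1 τ) 0 / (theta1 τ z * theta1 τ u)

/-- The kernel `y(u, z) = ∂x(u, z)/∂u`. -/
def y (τ u z : ℂ) : ℂ := deriv (fun s => x τ s z) u

variable {ℓ : ℕ}

/-- The positions have pairwise distinct images in `ℂ / (ℤ + ℤ τ)`. -/
def NonColliding (τ : ℍ) (q : Fin ℓ → ℂ) : Prop :=
  ∀ j k, j ≠ k → q j - q k ∉ Lambda τ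

/-- The Hamiltonian `½ ∑ pⱼ² + (g²/2) ∑_{j ≠ k} ℘(qⱼ - qₖ)`. -/
def hamiltonian (g : ℂ) (τ : ℍ) (q p : Fin ℓ → ℂ) : ℂ :=
  1 / 2 * ∑ j, p j ^ 2 +
    g ^ 2 / 2 * ∑ j, ∑ k ∈ Finset.univ.erase j, wp τ (q j - q k)

/-- The partial derivative `∂H/∂qⱼ`. -/
def dHdq (g : ℂ) (τ : ℍ) (q p : Fin ℓ → ℂ) (j : Fin ℓ) : ℂ :=
  deriv (fun s => hamiltonian g τ (Function.update q j s) p) (q j)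

/-- The partial derivative `∂H/∂pⱼ`. -/
def dHdp (g : ℂ) (τ : ℍ) (q p : Fin ℓ → ℂ) (j : Fin ℓ) : ℂ :=
  deriv (fun s => hamiltonian g τ q (Function.update p j s)) (p j)

/-- `(q, p)` is a holomorphic solution, on the part `U` of the upper half plane, of
`2πi dqⱼ/dτ = ∂H/∂pⱼ`, `2πi dpⱼ/dτ = -∂H/∂qⱼ`. -/
structure IsSolutionOn (g : ℂ) (U : Set ℂ) (q p : ℂ → Fin ℓ → ℂ) : Prop where
  isOpen : IsOpen U
  nonColliding : ∀ τ : ℍ, (τ : ℂ) ∈ U → NonColliding τ (q τ)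
  differentiableAt_q : ∀ τ : ℍ, (τ : ℂ) ∈ U → ∀ j, DifferentiableAt ℂ (fun t => q t j) τ
  differentiableAt_p : ∀ τ : ℍ, (τ : ℂ) ∈ U → ∀ j, DifferentiableAt ℂ (fun t => p t j) τ
  eq_q : ∀ τ : ℍ, (τ : ℂ) ∈ U → ∀ j,
    2 * Real.pi * Complex.I * deriv (fun t => q t j) τ = dHdp g τ (q τ) (p τ) j
  eq_p : ∀ τ : ℍ, (τ : ℂ) ∈ U → ∀ j,
    2 * Real.pi * Complex.I * deriv (fun t => p t j) τ = -dHdq g τ (q τ) (p τ) j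

/-- `L(z) = ∑ pⱼ Eⱼⱼ + i g ∑_{j ≠ k} x(qⱼ - qₖ, z) Eⱼₖ`. -/
def laxL (g τ : ℂ) (q p : Fin ℓ → ℂ) (z : ℂ) : Matrix (Fin ℓ) (Fin ℓ) ℂ :=
  Matrix.of fun j k => if j = k then p j else Complex.I * g * x τ (q j - q k) z

/-- `M(z) = ∑ Dⱼ Eⱼⱼ + i g ∑_{j ≠ k} y(qⱼ - qₖ, z) Eⱼₖ`, with
`Dⱼ = i g ∑_{k ≠ j} ℘(qⱼ - qₖ)`. -/
def laxM (g : ℂ) (τ : ℍ) (q : Fin ℓ → ℂ) (z : ℂ) : Matrix (Fin ℓ) (Fin ℓ) ℂ :=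
  Matrix.of fun j k =>
    if j = k then Complex.I * g * ∑ k ∈ Finset.univ.erase j, wp τ (q j - q k)
    else Complex.I * g * y τ (q j - q k) z

/-- The matrix `e^{c Q}`, where `Q = ∑ qⱼ Eⱼⱼ`. -/
def expQ (c : ℂ) (q : Fin ℓ → ℂ) : Matrix (Fin ℓ) (Fin ℓ) ℂ :=
  NormedSpace.exp (c • Matrix.diagonal q)

end EllipticCM

end

open scoped UpperHalfPlane

noncomputable section

namespace EllipticCM

open Complex Filter Topology

/-! Entry by entry, the zero-curvature equation is three identities for the kernels: the functional
equation `x_mul_y_sub` (cross terms off the diagonal), its degenerate case `x_mul_y_neg_sub` (on the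
diagonal, giving the force `℘'`), and the heat equation 2πi ∂x/∂τ + ∂²x/∂u∂z = 0 in
`hasDerivAt_x_comp`, which makes the `z`-derivative of `M` cancel the explicit `τ`-dependence of
`L`.

All three rest on one fact: entire functions with the quasi-periodicity of θ₁² form a space of
dimension at most two, because their Fourier coefficients obey a two-step recursion
(`fcoef_add_two`). The products θ₁(u+y)θ₁(u-y), their `y`-derivatives and θ₁²℘ all lie there, so any
three of them are linearly dependent; evaluating at well-chosen points identifies the coefficients.
This yields the zeros of θ₁, the formula for ℘(y) - ℘(u), `theta_addition` and `theta_heat`. The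
heat equation 4πi ∂θ₁/∂τ = θ₁'' is termwise in the series.

Part (ii) follows from the multipliers of θ₁. -/

/-! ### Theta series, termwise differentiation and the heat equation -/

/-- The summands of the `k`-th `u`-derivative of `-θ₁(u | τ)`. -/
def thetaTerm (k : ℕ) (n : ℤ) (τ u : ℂ) : ℂ :=
  (2 * Real.pi * I * ((n : ℂ) + 1 / 2)) ^ k *
    exp (Real.pi * I * τ * ((n : ℂ) + 1 / 2) ^ 2 +
      2 * Real.pi * I * ((n : ℂ) + 1 / 2) * (u + 1 / 2))

/-- The `k`-th `u`-derivative of `θ₁(u | τ)`, as a series. -/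
def thetaD (k : ℕ) (τ u : ℂ) : ℂ := -∑' n : ℤ, thetaTerm k n τ u

lemma theta1_eq_thetaD (τ : ℂ) : theta1 τ = thetaD 0 τ := by
  funext u
  simp only [theta1, thetaD, thetaTerm, pow_zero, one_mul]

/-- A summable majorant of `thetaTerm k` for `|Im u| ≤ S` and `T ≤ Im τ`. -/
def thetaBound (k : ℕ) (S T : ℝ) (n : ℤ) : ℝ :=
  (2 * Real.pi * (|(n : ℝ)| + 1)) ^ k *
    (Real.exp (Real.pi * S) *
      Real.exp (-Real.pi * (T * (n : ℝ) ^ 2 - 2 * (S + T / 2) * |(n : ℝ)|)))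

lemma summable_thetaBound (k : ℕ) (S : ℝ) {T : ℝ} (hT : 0 < T) :
    Summable (thetaBound k S T) := by
  have h0 := summable_pow_mul_jacobiTheta₂_term_bound (S + T / 2) hT 0
  have hk := summable_pow_mul_jacobiTheta₂_term_bound (S + T / 2) hT k
  refine Summable.of_nonneg_of_le (fun n => by unfold thetaBound; positivity) (fun n => ?_)
    ((hk.add h0).mul_left ((2 * Real.pi) ^ k * 2 ^ (k - 1) * Real.exp (Real.pi * S)))
  have h := add_pow_le (abs_nonneg (n : ℝ)) zero_le_one k
  rw [one_pow] at h
  unfold thetaBound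
  push_cast
  rw [mul_pow, pow_zero, ← add_mul]
  calc _ ≤ (2 * Real.pi) ^ k * (2 ^ (k - 1) * (|(n : ℝ)| ^ k + 1)) * (Real.exp (Real.pi * S) *
      Real.exp (-Real.pi * (T * (n : ℝ) ^ 2 - 2 * (S + T / 2) * |(n : ℝ)|))) := by gcongr
    _ = _ := by ring

/-- The half-integer shift costs only lower-order terms: (n + 1/2)² ≥ n² - |n| accounts for the `T /
2` beside `S`, and the 1/2 multiplying `u.im` for the factor `exp (π S)`. -/
lemma norm_thetaTerm_le (k : ℕ) {S T : ℝ} (hT : 0 ≤ T) {τ u : ℂ} (hu : |u.im| ≤ S)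
    (hτ : T ≤ τ.im) (n : ℤ) : ‖thetaTerm k n τ u‖ ≤ thetaBound k S T n := by
  unfold thetaTerm thetaBound
  rw [norm_mul, norm_pow, norm_exp, ← Real.exp_add]
  have hre : (Real.pi * I * τ * ((n : ℂ) + 1 / 2) ^ 2 +
      2 * Real.pi * I * ((n : ℂ) + 1 / 2) * (u + 1 / 2)).re =
      -Real.pi * τ.im * ((n : ℝ) + 1 / 2) ^ 2 - 2 * Real.pi * ((n : ℝ) + 1 / 2) * u.im := by
    have : Real.pi * I * τ * ((n : ℂ) + 1 / 2) ^ 2 +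
      2 * Real.pi * I * ((n : ℂ) + 1 / 2) * (u + 1 / 2) =
      ((Real.pi * ((n : ℝ) + 1 / 2) ^ 2 : ℝ) : ℂ) * τ * I +
      ((2 * Real.pi * ((n : ℝ) + 1 / 2) : ℝ) : ℂ) * (u + (1 / 2 : ℝ)) * I := by
        push_cast; ring
    rw [this, add_re, mul_I_re, mul_I_re, im_ofReal_mul, im_ofReal_mul, add_im, ofReal_im]
    ring
  have hn1 : ‖(2 * Real.pi * I * ((n : ℂ) + 1 / 2))‖ ≤ 2 * Real.pi * (|(n : ℝ)| + 1) := by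
    have : ‖(n : ℂ) + 1 / 2‖ ≤ |(n : ℝ)| + 1 := by
      refine (norm_add_le _ _).trans ?_
      rw [norm_intCast]
      gcongr
      norm_num
    rw [norm_mul, norm_mul, norm_mul, norm_I, norm_real, Real.norm_of_nonneg Real.pi_pos.le]
    norm_num
    gcongr
  have hn2 : -Real.pi * τ.im * ((n : ℝ) + 1 / 2) ^ 2 - 2 * Real.pi * ((n : ℝ) + 1 / 2) * u.im ≤
      Real.pi * S + -Real.pi * (T * (n : ℝ) ^ 2 - 2 * (S + T / 2) * |(n : ℝ)|) := by
    have h1 : T * ((n : ℝ) ^ 2 - |(n : ℝ)|) ≤ τ.im * ((n : ℝ) + 1 / 2) ^ 2 := by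
      calc _ ≤ T * ((n : ℝ) + 1 / 2) ^ 2 := by
            gcongr
            nlinarith [neg_abs_le (n : ℝ)]
        _ ≤ _ := by gcongr
    have h2 : -(((n : ℝ) + 1 / 2) * u.im) ≤ (|(n : ℝ)| + 1 / 2) * S := by
      calc _ ≤ |((n : ℝ) + 1 / 2) * u.im| := neg_le_abs _
        _ ≤ _ := by
          rw [abs_mul]
          gcongr
          exact (abs_add_le _ _).trans (by norm_num)
    nlinarith [mul_le_mul_of_nonneg_left h1 Real.pi_pos.le,
      mul_le_mul_of_nonneg_left h2 Real.pi_pos.le]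
  rw [hre]
  gcongr

lemma summable_thetaTerm (k : ℕ) {τ : ℂ} (hτ : 0 < τ.im) (u : ℂ) :
    Summable fun n : ℤ => thetaTerm k n τ u :=
  (summable_thetaBound k |u.im| hτ).of_norm_bounded
    fun n => norm_thetaTerm_le k hτ.le le_rfl le_rfl n

/-- The heat equation for the summands is built into this joint derivative. -/
lemma hasFDerivAt_thetaTerm (k : ℕ) (n : ℤ) (τ u : ℂ) :
    HasFDerivAt (fun p : ℂ × ℂ => thetaTerm k n p.1 p.2)
      ((thetaTerm (k + 2) n τ u / (4 * Real.pi * I)) • ContinuousLinearMap.fst ℂ ℂ ℂ +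
        thetaTerm (k + 1) n τ u • ContinuousLinearMap.snd ℂ ℂ ℂ) (τ, u) := by
  have hfst : HasFDerivAt (fun p : ℂ × ℂ => p.1) (ContinuousLinearMap.fst ℂ ℂ ℂ) (τ, u) :=
    hasFDerivAt_fst
  have hsnd : HasFDerivAt (fun p : ℂ × ℂ => p.2) (ContinuousLinearMap.snd ℂ ℂ ℂ) (τ, u) :=
    hasFDerivAt_snd
  have h := ((((hfst.const_mul (Real.pi * I)).mul_const (((n : ℂ) + 1 / 2) ^ 2)).add
    ((hsnd.add_const (1 / 2)).const_mul (2 * Real.pi * I * ((n : ℂ) + 1 / 2)))).cexp.const_mul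
      ((2 * Real.pi * I * ((n : ℂ) + 1 / 2)) ^ k))
  have hpi : (Real.pi : ℂ) ≠ 0 := by exact_mod_cast Real.pi_ne_zero
  refine h.congr_fderiv ?_
  ext
  · simp [thetaTerm]
    field_simp
    ring
  · simp [thetaTerm]
    ring

/-- The joint derivative of `θ₁⁽ᵏ⁾(u | τ)`; it contains the heat equation. -/
lemma hasFDerivAt_thetaD (k : ℕ) {τ : ℂ} (hτ : 0 < τ.im) (u : ℂ) :
    HasFDerivAt (fun p : ℂ × ℂ => thetaD k p.1 p.2)
      ((thetaD (k + 2) τ u / (4 * Real.pi * I)) • ContinuousLinearMap.fst ℂ ℂ ℂ +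
        thetaD (k + 1) τ u • ContinuousLinearMap.snd ℂ ℂ ℂ) (τ, u) := by
  obtain ⟨T, hT, hτ'⟩ := exists_between hτ
  obtain ⟨S, hu⟩ := exists_gt |u.im|
  -- A half plane times a strip is a convex neighbourhood on which one majorant serves all terms.
  let V : Set (ℂ × ℂ) := {t | T < im t} ×ˢ {v | |im v| < S}
  have hVo : IsOpen V :=
    (continuous_im.isOpen_preimage _ isOpen_Ioi).prod
      ((_root_.continuous_abs.comp continuous_im).isOpen_preimage _ isOpen_Iio)
  have hVp : IsPreconnected V := by
    refine (convex_halfSpace_im_gt T).isPreconnected.prod (Convex.isPreconnected ?_)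
    have h : {v : ℂ | |im v| < S} = {v : ℂ | -S < im v} ∩ {v : ℂ | im v < S} := by
      ext v
      simp [abs_lt]
    rw [h]
    exact (convex_halfSpace_im_gt _).inter (convex_halfSpace_im_lt _)
  have hmem : ((τ, u) : ℂ × ℂ) ∈ V := ⟨hτ', hu⟩
  have hns (a : ℂ) (f : ℂ × ℂ →L[ℂ] ℂ) : ‖a • f‖ = ‖a‖ * ‖f‖ := norm_smul a f
  have hbd : ∀ (n : ℤ) (p : ℂ × ℂ), p ∈ V →
      ‖(thetaTerm (k + 2) n p.1 p.2 / (4 * Real.pi * I)) • ContinuousLinearMap.fst ℂ ℂ ℂ +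
        thetaTerm (k + 1) n p.1 p.2 • ContinuousLinearMap.snd ℂ ℂ ℂ‖ ≤
      thetaBound (k + 2) S T n / ‖(4 * Real.pi * I : ℂ)‖ + thetaBound (k + 1) S T n := by
    rintro n ⟨t, v⟩ ⟨ht, hv⟩
    refine (norm_add_le _ _).trans (add_le_add ?_ ?_)
    · rw [hns, norm_div]
      calc _ ≤ ‖thetaTerm (k + 2) n t v‖ / ‖(4 * Real.pi * I : ℂ)‖ * 1 := by
            gcongr
            exact ContinuousLinearMap.norm_fst_le ..
        _ ≤ _ := by
            rw [mul_one]
            gcongr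
            exact norm_thetaTerm_le _ hT.le (le_of_lt hv) (le_of_lt ht) n
    · rw [hns]
      calc _ ≤ ‖thetaTerm (k + 1) n t v‖ * 1 := by
            gcongr
            exact ContinuousLinearMap.norm_snd_le ..
        _ ≤ _ := by
            rw [mul_one]
            exact norm_thetaTerm_le _ hT.le (le_of_lt hv) (le_of_lt ht) n
  have key := (hasFDerivAt_tsum_of_isPreconnected
    (((summable_thetaBound (k + 2) S hT).div_const _).add (summable_thetaBound (k + 1) S hT))
    hVo hVp (fun n (p : ℂ × ℂ) _ => hasFDerivAt_thetaTerm k n p.1 p.2) hbd hmem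
    (summable_thetaTerm k hτ u) hmem).neg
  refine key.congr_fderiv ?_
  have e1 : Summable fun n : ℤ => (thetaTerm (k + 2) n τ u / (4 * Real.pi * I)) •
      ContinuousLinearMap.fst ℂ ℂ ℂ :=
    ((summable_thetaTerm (k + 2) hτ u).div_const _).smul_const _
  have e2 : Summable fun n : ℤ => thetaTerm (k + 1) n τ u • ContinuousLinearMap.snd ℂ ℂ ℂ :=
    (summable_thetaTerm (k + 1) hτ u).smul_const _
  rw [e1.tsum_add e2, ((summable_thetaTerm (k + 2) hτ u).div_const _).tsum_smul_const,
    (summable_thetaTerm (k + 1) hτ u).tsum_smul_const, tsum_div_const]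
  ext <;> simp [thetaD, neg_div]

/-- Differentiation of `θ₁⁽ᵏ⁾` along a curve in `(τ, u)`. -/
lemma hasDerivAt_thetaD_comp (k : ℕ) {τ : ℂ} (hτ : 0 < τ.im) {f : ℂ → ℂ} {f' : ℂ}
    (hf : HasDerivAt f f' τ) :
    HasDerivAt (fun t => thetaD k t (f t))
      (thetaD (k + 2) τ (f τ) / (4 * Real.pi * I) + thetaD (k + 1) τ (f τ) * f') τ := by
  have h := (hasFDerivAt_thetaD k hτ (f τ)).comp_hasDerivAt τ ((hasDerivAt_id τ).prodMk hf)
  refine h.congr_deriv ?_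
  simp

lemma hasDerivAt_thetaD (k : ℕ) {τ : ℂ} (hτ : 0 < τ.im) (u : ℂ) :
    HasDerivAt (thetaD k τ) (thetaD (k + 1) τ u) u := by
  have h := (hasFDerivAt_thetaD k hτ u).comp_hasDerivAt u
    ((hasDerivAt_const u τ).prodMk (hasDerivAt_id u))
  refine h.congr_deriv ?_
  simp

lemma deriv_theta1 {τ : ℂ} (hτ : 0 < τ.im) : deriv (theta1 τ) = thetaD 1 τ := by
  rw [theta1_eq_thetaD]
  exact funext fun u => (hasDerivAt_thetaD 0 hτ u).deriv

lemma differentiable_thetaD (k : ℕ) {τ : ℂ} (hτ : 0 < τ.im) : Differentiable ℂ (thetaD k τ) :=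
  fun u => (hasDerivAt_thetaD k hτ u).differentiableAt

/-! ### Multipliers and parity of θ₁ -/

lemma thetaD_zero_add_one (τ u : ℂ) : thetaD 0 τ (u + 1) = -thetaD 0 τ u := by
  simp only [thetaD, ← tsum_neg]
  refine tsum_congr fun n => ?_
  simp only [thetaTerm, pow_zero, one_mul]
  rw [show Real.pi * I * τ * ((n : ℂ) + 1 / 2) ^ 2 +
      2 * Real.pi * I * ((n : ℂ) + 1 / 2) * (u + 1 + 1 / 2) =
      Real.pi * I * τ * ((n : ℂ) + 1 / 2) ^ 2 +
      2 * Real.pi * I * ((n : ℂ) + 1 / 2) * (u + 1 / 2) + n * (2 * Real.pi * I) + Real.pi * I by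
        ring, exp_add, exp_add, exp_int_mul_two_pi_mul_I, exp_pi_mul_I]
  ring

lemma thetaD_zero_add_tau (τ u : ℂ) :
    thetaD 0 τ (u + τ) = -exp (-(Real.pi * I * τ) - 2 * Real.pi * I * u) * thetaD 0 τ u := by
  have h : ∀ n : ℤ, thetaTerm 0 n τ (u + τ) =
      -exp (-(Real.pi * I * τ) - 2 * Real.pi * I * u) * thetaTerm 0 (n + 1) τ u := by
    intro n
    simp only [thetaTerm, pow_zero, one_mul]
    have e : exp (-(Real.pi * I)) = -1 := by rw [exp_neg, exp_pi_mul_I]; norm_num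
    rw [show -exp (-(Real.pi * I * τ) - 2 * Real.pi * I * u) =
      exp (-(Real.pi * I)) * exp (-(Real.pi * I * τ) - 2 * Real.pi * I * u) by rw [e]; ring,
      ← exp_add, ← exp_add]
    congr 1
    push_cast
    ring
  simp only [thetaD]
  rw [funext h, tsum_mul_left, ← (Equiv.addRight (1 : ℤ)).tsum_eq (fun n => thetaTerm 0 n τ u)]
  simp only [Equiv.coe_addRight]
  ring

lemma thetaD_zero_neg (τ u : ℂ) : thetaD 0 τ (-u) = -thetaD 0 τ u := by
  have h : ∀ n : ℤ, thetaTerm 0 (-n - 1) τ (-u) = -thetaTerm 0 n τ u := by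
    intro n
    simp only [thetaTerm, pow_zero, one_mul]
    rw [show Real.pi * I * τ * (((-n - 1 : ℤ) : ℂ) + 1 / 2) ^ 2 +
        2 * Real.pi * I * (((-n - 1 : ℤ) : ℂ) + 1 / 2) * (-u + 1 / 2) =
        Real.pi * I * τ * ((n : ℂ) + 1 / 2) ^ 2 +
        2 * Real.pi * I * ((n : ℂ) + 1 / 2) * (u + 1 / 2) + (-n - 1 : ℤ) * (2 * Real.pi * I)
        + Real.pi * I by push_cast; ring, exp_add, exp_add, exp_int_mul_two_pi_mul_I,
      exp_pi_mul_I]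
    ring
  simp only [thetaD]
  rw [← ((Equiv.neg ℤ).trans (Equiv.subRight (1 : ℤ))).tsum_eq (fun n => thetaTerm 0 n τ (-u))]
  simp only [Equiv.trans_apply, Equiv.neg_apply, Equiv.subRight_apply, h, tsum_neg]

lemma thetaD_zero_zero (τ : ℂ) : thetaD 0 τ 0 = 0 := by
  have h := thetaD_zero_neg τ 0
  rw [neg_zero] at h
  exact self_eq_neg.mp h

lemma thetaD_one_neg {τ : ℂ} (hτ : 0 < τ.im) (u : ℂ) : thetaD 1 τ (-u) = thetaD 1 τ u := by
  have h1 : HasDerivAt (fun v => thetaD 0 τ (-v)) (thetaD 1 τ (-u) * (-1)) u :=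
    (hasDerivAt_thetaD 0 hτ (-u)).comp u (hasDerivAt_neg u)
  have h2 : HasDerivAt (fun v => thetaD 0 τ (-v)) (-thetaD 1 τ u) u := by
    simp only [thetaD_zero_neg]
    exact (hasDerivAt_thetaD 0 hτ u).neg
  linear_combination -(h1.unique h2)

lemma thetaD_two_neg {τ : ℂ} (hτ : 0 < τ.im) (u : ℂ) : thetaD 2 τ (-u) = -thetaD 2 τ u := by
  have h1 : HasDerivAt (fun v => thetaD 1 τ (-v)) (thetaD 2 τ (-u) * (-1)) u :=
    (hasDerivAt_thetaD 1 hτ (-u)).comp u (hasDerivAt_neg u)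
  have h2 : HasDerivAt (fun v => thetaD 1 τ (-v)) (thetaD 2 τ u) u := by
    simp only [thetaD_one_neg hτ]
    exact hasDerivAt_thetaD 1 hτ u
  linear_combination -(h1.unique h2)

lemma thetaD_two_zero {τ : ℂ} (hτ : 0 < τ.im) : thetaD 2 τ 0 = 0 := by
  have h := thetaD_two_neg hτ 0
  rw [neg_zero] at h
  exact self_eq_neg.mp h

/-! ### Fourier coefficients of entire periodic functions -/

section Fourier

variable {F : ℂ → ℂ}

/-- The integral of an entire `1`-periodic function over a horizontal unit segment does not depend
on the segment. -/
lemma integral_add_eq_of_periodic (hF : Differentiable ℂ F) (hp : ∀ u, F (u + 1) = F u) (c : ℂ) :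
    ∫ t in (0 : ℝ)..1, F (t + c) = ∫ t in (0 : ℝ)..1, F t := by
  -- With a primitive `H`, the integral is `H (1 + d) - H d`, whose `d`-derivative vanishes by
  -- periodicity. The ball is large enough to contain every segment used.
  obtain ⟨H, hH⟩ := (hF.differentiableOn (s := Metric.ball 0 (‖c‖ + 2))).isExactOn_ball
  have hH' : ∀ d : ℂ, ‖d‖ < ‖c‖ + 2 → HasDerivAt H (F d) d := fun d hd =>
    hH d (by simpa using hd)
  have key : ∀ d : ℂ, ‖d‖ < ‖c‖ + 1 → ∫ t in (0 : ℝ)..1, F (t + d) = H (1 + d) - H d := by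
    intro d hd
    have h : ∀ t ∈ Set.uIcc (0 : ℝ) 1, HasDerivAt (fun t : ℝ => H (t + d)) (F (t + d)) t := by
      intro t ht
      rw [Set.uIcc_of_le zero_le_one] at ht
      have hn : ‖(t : ℂ) + d‖ < ‖c‖ + 2 := by
        refine (norm_add_le _ _).trans_lt ?_
        rw [norm_real, Real.norm_of_nonneg ht.1]
        linarith [ht.2]
      exact ((hH' _ hn).comp_add_const (t : ℂ) d).comp_ofReal
    rw [intervalIntegral.integral_eq_sub_of_hasDerivAt h]
    · simp
    · refine Continuous.intervalIntegrable ?_ _ _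
      exact hF.continuous.comp (by fun_prop)
  have hK : ∀ d ∈ Metric.ball (0 : ℂ) (‖c‖ + 1),
      HasDerivAt (fun d => H (1 + d) - H d) 0 d := by
    intro d hd
    have hd' : ‖d‖ < ‖c‖ + 1 := by simpa using hd
    have h1 : ‖1 + d‖ < ‖c‖ + 2 := by
      refine (norm_add_le _ _).trans_lt ?_
      rw [norm_one]
      linarith
    have := (hH' _ h1).comp_const_add 1 d |>.sub (hH' d (by linarith))
    rw [add_comm, hp, sub_self] at this
    exact this
  have hc := Metric.isOpen_ball.is_const_of_deriv_eq_zero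
    (convex_ball (0 : ℂ) (‖c‖ + 1)).isPreconnected
    (fun d hd => (hK d hd).differentiableAt.differentiableWithinAt)
    (fun d hd => (hK d hd).deriv) (x := c) (y := 0) (by simp) (by simp; positivity)
  have h0 := key 0 (by simp; positivity)
  simp only [add_zero] at h0
  rw [key c (by linarith), h0]
  simpa using hc

/-- The `n`-th Fourier coefficient of the restriction of `F` to the real line. -/
def fcoef (F : ℂ → ℂ) (n : ℤ) : ℂ :=
  ∫ t in (0 : ℝ)..1, exp (-(2 * Real.pi * I * n * t)) * F t

/-- Zero coefficients are summable, so the Fourier series converges pointwise and `F` vanishes on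
the real line; the points 1/(n+1) accumulate at 0, and the identity theorem finishes. -/
lemma eq_zero_of_fcoef_eq_zero (hF : Differentiable ℂ F) (hp : ∀ u, F (u + 1) = F u)
    (h : ∀ n, fcoef F n = 0) (u : ℂ) : F u = 0 := by
  have hper : Function.Periodic (fun t : ℝ => F t) 1 := fun t => by simpa using hp t
  let f : C(AddCircle (1 : ℝ), ℂ) := ⟨hper.lift, by
    refine continuous_coinduced_dom.mpr ?_
    exact hF.continuous.comp continuous_ofReal⟩
  have hf : ∀ t : ℝ, f (t : AddCircle (1 : ℝ)) = F t := fun t => hper.lift_coe t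
  have hc : ∀ n, fourierCoeff f n = 0 := by
    intro n
    rw [fourierCoeff_eq_intervalIntegral _ n 0, ← h n, fcoef]
    simp only [hf, fourier_coe_apply, smul_eq_mul, zero_add, div_one, one_smul]
    refine intervalIntegral.integral_congr fun t _ => ?_
    congr 2
    push_cast
    ring
  have hreal : ∀ t : ℝ, F t = 0 := by
    intro t
    have hs : Summable (fourierCoeff f) := by
      rw [funext hc]
      exact summable_zero
    have := has_pointwise_sum_fourier_series_of_summable hs (t : AddCircle (1 : ℝ))
    simp only [hc, zero_smul, hf] at this
    exact this.unique hasSum_zero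
  have han : AnalyticOnNhd ℂ F Set.univ := fun z _ => hF.analyticAt z
  refine congrFun (han.eq_of_frequently_eq (g := 0) (fun z _ => analyticAt_const) (z₀ := 0) ?_) u
  have ht : Tendsto (fun n : ℕ => ((1 / ((n : ℝ) + 1) : ℝ) : ℂ)) atTop (𝓝[≠] 0) := by
    refine tendsto_nhdsWithin_iff.mpr ⟨?_, Eventually.of_forall fun n => ?_⟩
    · have := (continuous_ofReal.tendsto 0).comp (tendsto_one_div_add_atTop_nhds_zero_nat (𝕜 := ℝ))
      rw [ofReal_zero] at this
      exact this
    · simp only [Set.mem_compl_iff, Set.mem_singleton_iff, ofReal_eq_zero]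
      positivity
  exact ht.frequently (Frequently.of_forall fun n => hreal _)

end Fourier

/-! ### The space of second-order theta functions -/

/-- Entire functions with the quasi-periodicity of `θ₁(u | τ)²`. -/
def theta2Space (τ : ℂ) : Submodule ℂ (ℂ → ℂ) where
  carrier := {F | Differentiable ℂ F ∧ (∀ u, F (u + 1) = F u) ∧
    ∀ u, F (u + τ) = exp (-(2 * Real.pi * I * τ) - 4 * Real.pi * I * u) * F u}
  add_mem' := by
    rintro F G ⟨h1, h2, h3⟩ ⟨k1, k2, k3⟩
    refine ⟨h1.add k1, fun u => ?_, fun u => ?_⟩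
    · simp [h2, k2]
    · simp only [Pi.add_apply, h3, k3]
      ring
  zero_mem' := ⟨differentiable_const 0, fun u => rfl, fun u => by simp⟩
  smul_mem' := by
    rintro c F ⟨h1, h2, h3⟩
    refine ⟨h1.const_smul c, fun u => ?_, fun u => ?_⟩
    · simp [h2]
    · simp only [Pi.smul_apply, smul_eq_mul, h3]
      ring

/-- Moving the segment of integration by `τ` brings in the multiplier, whose factor e^{-4πiu} shifts
the frequency by two. -/
lemma fcoef_add_two {τ : ℂ} {F : ℂ → ℂ} (hF : F ∈ theta2Space τ) (n : ℤ) :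
    fcoef F n = exp (-(2 * Real.pi * I * (n + 1) * τ)) * fcoef F (n + 2) := by
  obtain ⟨h1, h2, h3⟩ := hF
  have h := integral_add_eq_of_periodic (F := fun u => exp (-(2 * Real.pi * I * n * u)) * F u)
    (by fun_prop) (fun u => by
      rw [h2, show -(2 * Real.pi * I * n * (u + 1)) = -(2 * Real.pi * I * n * u) +
        (-n : ℤ) * (2 * Real.pi * I) by push_cast; ring, exp_add, exp_int_mul_two_pi_mul_I,
        mul_one]) τ
  rw [fcoef, ← h, fcoef, ← intervalIntegral.integral_const_mul]
  refine intervalIntegral.integral_congr fun t _ => ?_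
  simp only [h3]
  rw [← mul_assoc, ← mul_assoc, ← exp_add, ← exp_add]
  congr 2
  push_cast
  ring

lemma eq_zero_of_mem_theta2Space {τ : ℂ} {F : ℂ → ℂ} (hF : F ∈ theta2Space τ)
    (h0 : fcoef F 0 = 0) (h1 : fcoef F 1 = 0) (u : ℂ) : F u = 0 := by
  refine eq_zero_of_fcoef_eq_zero hF.1 hF.2.1 (fun n => ?_) u
  have hstep : ∀ n : ℤ, fcoef F n = 0 ↔ fcoef F (n + 2) = 0 := fun n => by
    rw [fcoef_add_two hF n, mul_eq_zero, or_iff_right (exp_ne_zero _)]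
  have hboth : ∀ n : ℤ, fcoef F n = 0 ∧ fcoef F (n + 1) = 0 := by
    intro n
    induction n using Int.induction_on with
    | zero => exact ⟨h0, by simpa using h1⟩
    | succ n ih => exact ⟨ih.2, by
        have := (hstep n).mp ih.1
        rwa [show (n : ℤ) + 1 + 1 = n + 2 by ring]⟩
    | pred n ih => exact ⟨(hstep _).mpr (by
        rw [show -(n : ℤ) - 1 + 2 = -n + 1 by ring]; exact ih.2), by
        rw [show -(n : ℤ) - 1 + 1 = -n by ring]; exact ih.1⟩
  exact (hboth n).1

/-- The space `theta2Space τ` has dimension at most two. -/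
lemma exists_relation_of_mem_theta2Space {τ : ℂ} {F G H : ℂ → ℂ} (hF : F ∈ theta2Space τ)
    (hG : G ∈ theta2Space τ) (hH : H ∈ theta2Space τ) :
    ∃ a b c : ℂ, (a ≠ 0 ∨ b ≠ 0 ∨ c ≠ 0) ∧ ∀ u, a * F u + b * G u + c * H u = 0 := by
  have hlin : ∀ (a b c : ℂ) (n : ℤ), fcoef (a • F + b • G + c • H) n =
      a * fcoef F n + b * fcoef G n + c * fcoef H n := by
    intro a b c n
    have hi : ∀ K : ℂ → ℂ, K ∈ theta2Space τ → IntervalIntegrable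
        (fun t : ℝ => exp (-(2 * Real.pi * I * n * t)) * K t) MeasureTheory.volume 0 1 := by
      intro K hK
      have := hK.1.continuous
      exact Continuous.intervalIntegrable (by fun_prop) _ _
    simp only [fcoef]
    rw [← intervalIntegral.integral_const_mul, ← intervalIntegral.integral_const_mul,
      ← intervalIntegral.integral_const_mul, ← intervalIntegral.integral_add,
      ← intervalIntegral.integral_add]
    · refine intervalIntegral.integral_congr fun t _ => ?_
      simp only [Pi.add_apply, Pi.smul_apply, smul_eq_mul]
      ring
    · exact ((hi F hF).const_mul a).add ((hi G hG).const_mul b)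
    · exact (hi H hH).const_mul c
    · exact (hi F hF).const_mul a
    · exact (hi G hG).const_mul b
  -- Coefficients 0 and 1 determine an element of the space, so a dependence among three vectors of
  -- ℂ² lifts to the functions.
  let v : Fin 3 → (Fin 2 → ℂ) :=
    ![![fcoef F 0, fcoef F 1], ![fcoef G 0, fcoef G 1], ![fcoef H 0, fcoef H 1]]
  have hv : ¬LinearIndependent ℂ v := fun h => by
    have := h.fintype_card_le_finrank
    simp at this
  obtain ⟨g, hg, i, hi⟩ := Fintype.not_linearIndependent_iff.mp hv
  have e0 := congrFun hg 0
  have e1 := congrFun hg 1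
  simp [Fin.sum_univ_three, v] at e0 e1
  refine ⟨g 0, g 1, g 2, ?_, fun u => ?_⟩
  · by_contra! hcon
    fin_cases i <;> simp_all
  · have hmem : g 0 • F + g 1 • G + g 2 • H ∈ theta2Space τ :=
      add_mem (add_mem (Submodule.smul_mem _ _ hF) (Submodule.smul_mem _ _ hG))
        (Submodule.smul_mem _ _ hH)
    exact eq_zero_of_mem_theta2Space hmem ((hlin _ _ _ 0).trans e0) ((hlin _ _ _ 1).trans e1) u

/-- `θ₁(· | τ)` does not vanish identically. -/
lemma exists_thetaD_zero_ne_zero {τ : ℂ} (hτ : 0 < τ.im) : ∃ u, thetaD 0 τ u ≠ 0 := by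
  by_contra! hz
  -- Integration against e^{-πit} isolates the term `n = 0`, which is an exponential and hence
  -- nonzero.
  have hsum : HasSum (fun n : ℤ => ∫ t in (0 : ℝ)..1, exp (-(Real.pi * I * t)) * thetaTerm 0 n τ t)
      (∫ t in (0 : ℝ)..1, exp (-(Real.pi * I * t)) * -thetaD 0 τ t) := by
    refine intervalIntegral.hasSum_integral_of_dominated_convergence
      (fun n _ => thetaBound 0 0 τ.im n) (fun n => ?_) (fun n => ?_) ?_ ?_ ?_
    · refine Continuous.aestronglyMeasurable ?_
      unfold thetaTerm
      fun_prop
    · refine Eventually.of_forall fun t _ => ?_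
      rw [norm_mul, show -(Real.pi * I * t) = ((-(Real.pi * t) : ℝ) : ℂ) * I by push_cast; ring,
        norm_exp_ofReal_mul_I, one_mul]
      exact norm_thetaTerm_le 0 hτ.le (by simp) le_rfl n
    · exact Eventually.of_forall fun t _ => summable_thetaBound 0 0 hτ
    · exact intervalIntegrable_const
    · refine Eventually.of_forall fun t _ => ?_
      rw [thetaD, neg_neg]
      exact (summable_thetaTerm 0 hτ t).hasSum.mul_left _
  have hterm : ∀ n : ℤ, n ≠ 0 →
      ∫ t in (0 : ℝ)..1, exp (-(Real.pi * I * t)) * thetaTerm 0 n τ t = 0 := by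
    intro n hn
    have hc : (2 * Real.pi * I * n : ℂ) ≠ 0 := by
      simp [Real.pi_ne_zero, I_ne_zero, hn]
    have : ∀ t : ℝ, exp (-(Real.pi * I * t)) * thetaTerm 0 n τ t =
        exp (Real.pi * I * τ * ((n : ℂ) + 1 / 2) ^ 2 + Real.pi * I * ((n : ℂ) + 1 / 2)) *
          exp (2 * Real.pi * I * n * t) := by
      intro t
      rw [thetaTerm, pow_zero, one_mul, ← exp_add, ← exp_add]
      congr 1
      ring
    simp only [this]
    rw [intervalIntegral.integral_const_mul, integral_exp_mul_complex hc]
    simp only [ofReal_one, mul_one, ofReal_zero, mul_zero, exp_zero]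
    rw [show (2 * Real.pi * I * n : ℂ) = n * (2 * Real.pi * I) by ring,
      exp_int_mul_two_pi_mul_I]
    simp
  have h0 := hsum.unique (hasSum_single 0 hterm)
  simp only [hz, neg_zero, mul_zero, intervalIntegral.integral_zero] at h0
  have : ∀ t : ℝ, exp (-(Real.pi * I * t)) * thetaTerm 0 0 τ t =
      exp (Real.pi * I * τ * (1 / 2) ^ 2 + Real.pi * I * (1 / 2)) := by
    intro t
    rw [thetaTerm, pow_zero, one_mul, ← exp_add]
    congr 1
    push_cast
    ring
  simp only [this, intervalIntegral.integral_const] at h0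
  simp at h0
  exact exp_ne_zero _ h0.symm

/-! ### Products of theta functions inside `theta2Space` -/

section Quasiperiodicity

variable {τ : ℂ}

lemma thetaD_one_add_one (hτ : 0 < τ.im) (u : ℂ) : thetaD 1 τ (u + 1) = -thetaD 1 τ u := by
  have h1 := (hasDerivAt_thetaD 0 hτ (u + 1)).comp_add_const u 1
  simp only [thetaD_zero_add_one] at h1
  exact h1.unique (hasDerivAt_thetaD 0 hτ u).neg

lemma thetaD_two_add_one (hτ : 0 < τ.im) (u : ℂ) : thetaD 2 τ (u + 1) = -thetaD 2 τ u := by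
  have h1 := (hasDerivAt_thetaD 1 hτ (u + 1)).comp_add_const u 1
  simp only [thetaD_one_add_one hτ] at h1
  exact h1.unique (hasDerivAt_thetaD 1 hτ u).neg

/-- The multiplier of `θ₁` for the period `τ`. -/
def thetaMul (τ u : ℂ) : ℂ := -exp (-(Real.pi * I * τ) - 2 * Real.pi * I * u)

lemma thetaMul_ne_zero (τ u : ℂ) : thetaMul τ u ≠ 0 := neg_ne_zero.mpr (exp_ne_zero _)

lemma hasDerivAt_thetaMul (τ u : ℂ) :
    HasDerivAt (thetaMul τ) (-(2 * Real.pi * I) * thetaMul τ u) u := by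
  have h := ((((hasDerivAt_id u).const_mul (2 * Real.pi * I)).const_sub
    (-(Real.pi * I * τ))).cexp).neg
  refine h.congr_deriv ?_
  simp only [thetaMul, id]
  ring

/-- The product of the two multipliers does not depend on `y`; hence `thetaProd` and its
`y`-derivatives share one quasi-periodicity. -/
lemma thetaMul_mul (τ u y : ℂ) : thetaMul τ (u + y) * thetaMul τ (u - y) =
    exp (-(2 * Real.pi * I * τ) - 4 * Real.pi * I * u) := by
  rw [thetaMul, thetaMul, neg_mul_neg, ← exp_add]
  congr 1
  ring

lemma thetaD_zero_add_tau' (τ u : ℂ) :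
    thetaD 0 τ (u + τ) = thetaMul τ u * thetaD 0 τ u :=
  thetaD_zero_add_tau τ u

lemma thetaD_one_add_tau (hτ : 0 < τ.im) (u : ℂ) :
    thetaD 1 τ (u + τ) = thetaMul τ u * (thetaD 1 τ u - 2 * Real.pi * I * thetaD 0 τ u) := by
  have h1 := (hasDerivAt_thetaD 0 hτ (u + τ)).comp_add_const u τ
  simp only [thetaD_zero_add_tau'] at h1
  rw [h1.unique ((hasDerivAt_thetaMul τ u).mul (hasDerivAt_thetaD 0 hτ u))]
  ring

lemma thetaD_two_add_tau (hτ : 0 < τ.im) (u : ℂ) :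
    thetaD 2 τ (u + τ) = thetaMul τ u * (thetaD 2 τ u - 4 * Real.pi * I * thetaD 1 τ u +
      (2 * Real.pi * I) ^ 2 * thetaD 0 τ u) := by
  have h1 := (hasDerivAt_thetaD 1 hτ (u + τ)).comp_add_const u τ
  simp only [thetaD_one_add_tau hτ] at h1
  rw [h1.unique ((hasDerivAt_thetaMul τ u).mul ((hasDerivAt_thetaD 1 hτ u).sub
    ((hasDerivAt_thetaD 0 hτ u).const_mul (2 * Real.pi * I))))]
  ring

/-- `u ↦ θ₁(u + y) θ₁(u - y)`. -/
def thetaProd (τ y u : ℂ) : ℂ := thetaD 0 τ (u + y) * thetaD 0 τ (u - y)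

/-- The first `y`-derivative of `thetaProd`. -/
def thetaProd₁ (τ y u : ℂ) : ℂ :=
  thetaD 1 τ (u + y) * thetaD 0 τ (u - y) - thetaD 0 τ (u + y) * thetaD 1 τ (u - y)

/-- The second `y`-derivative of `thetaProd`. -/
def thetaProd₂ (τ y u : ℂ) : ℂ :=
  thetaD 2 τ (u + y) * thetaD 0 τ (u - y) - 2 * (thetaD 1 τ (u + y) * thetaD 1 τ (u - y)) +
    thetaD 0 τ (u + y) * thetaD 2 τ (u - y)

lemma thetaProd_mem (hτ : 0 < τ.im) (y : ℂ) : thetaProd τ y ∈ theta2Space τ := by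
  have h0 := differentiable_thetaD 0 hτ
  refine ⟨by unfold thetaProd; fun_prop, fun u => ?_, fun u => ?_⟩
  · simp only [thetaProd, add_right_comm, add_sub_right_comm, thetaD_zero_add_one]
    ring
  · simp only [thetaProd, add_right_comm u τ, add_sub_right_comm u τ, thetaD_zero_add_tau']
    rw [← thetaMul_mul τ u y]
    ring

lemma thetaProd₁_mem (hτ : 0 < τ.im) (y : ℂ) : thetaProd₁ τ y ∈ theta2Space τ := by
  have h0 := differentiable_thetaD 0 hτ
  have h1 := differentiable_thetaD 1 hτ
  refine ⟨by unfold thetaProd₁; fun_prop, fun u => ?_, fun u => ?_⟩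
  · simp only [thetaProd₁, add_right_comm, add_sub_right_comm, thetaD_zero_add_one,
      thetaD_one_add_one hτ]
    ring
  · simp only [thetaProd₁, add_right_comm u τ, add_sub_right_comm u τ, thetaD_zero_add_tau',
      thetaD_one_add_tau hτ]
    rw [← thetaMul_mul τ u y]
    ring

lemma thetaProd₂_mem (hτ : 0 < τ.im) (y : ℂ) : thetaProd₂ τ y ∈ theta2Space τ := by
  have h0 := differentiable_thetaD 0 hτ
  have h1 := differentiable_thetaD 1 hτ
  have h2 := differentiable_thetaD 2 hτ
  refine ⟨by unfold thetaProd₂; fun_prop, fun u => ?_, fun u => ?_⟩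
  · simp only [thetaProd₂, add_right_comm, add_sub_right_comm, thetaD_zero_add_one,
      thetaD_one_add_one hτ, thetaD_two_add_one hτ]
    ring
  · simp only [thetaProd₂, add_right_comm u τ, add_sub_right_comm u τ, thetaD_zero_add_tau',
      thetaD_one_add_tau hτ, thetaD_two_add_tau hτ]
    rw [← thetaMul_mul τ u y]
    ring

lemma eventually_thetaD_zero_ne_zero (hτ : 0 < τ.im) (a : ℂ) :
    ∀ᶠ u in 𝓝[≠] a, thetaD 0 τ u ≠ 0 := by
  by_contra h
  obtain ⟨u, hu⟩ := exists_thetaD_zero_ne_zero hτ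
  have han : AnalyticOnNhd ℂ (thetaD 0 τ) Set.univ :=
    fun z _ => (differentiable_thetaD 0 hτ).analyticAt z
  refine hu (congrFun (han.eq_of_frequently_eq (g := 0) (fun z _ => analyticAt_const)
    (z₀ := a) ?_) u)
  exact (not_eventually.mp h).mono fun _ h => not_not.mp h

/-- Zeros of θ₁ are isolated, so a small `y ≠ 0` works. Thus `theta2Space` has no common zero. -/
lemma exists_thetaProd_ne_zero (hτ : 0 < τ.im) (a : ℂ) : ∃ y, thetaProd τ y a ≠ 0 := by
  have h1 : Tendsto (fun y => a + y) (𝓝[≠] 0) (𝓝[≠] a) := by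
    refine tendsto_nhdsWithin_iff.mpr ⟨?_, ?_⟩
    · exact (Continuous.tendsto' (by fun_prop) _ _ (by simp)).mono_left nhdsWithin_le_nhds
    · filter_upwards [self_mem_nhdsWithin] with y hy
      simpa using hy
  have h2 : Tendsto (fun y => a - y) (𝓝[≠] 0) (𝓝[≠] a) := by
    refine tendsto_nhdsWithin_iff.mpr ⟨?_, ?_⟩
    · exact (Continuous.tendsto' (by fun_prop) _ _ (by simp)).mono_left nhdsWithin_le_nhds
    · filter_upwards [self_mem_nhdsWithin] with y hy
      simpa using hy
  obtain ⟨y, hy1, hy2⟩ := ((h1.eventually (eventually_thetaD_zero_ne_zero hτ a)).and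
    (h2.eventually (eventually_thetaD_zero_ne_zero hτ a))).exists
  exact ⟨y, mul_ne_zero hy1 hy2⟩

end Quasiperiodicity

/-! ### Zeros of θ₁ and the link with ℘ -/

section Zeros

variable (τ : ℍ)

lemma one_mem_lattice : (1 : ℂ) ∈ (periods τ).lattice := (periods τ).ω₁_mem_lattice

lemma tau_mem_lattice : (τ : ℂ) ∈ (periods τ).lattice := (periods τ).ω₂_mem_lattice

lemma thetaD_zero_of_mem {u : ℂ} (hu : u ∈ (periods τ).lattice) : thetaD 0 τ u = 0 := by
  -- Translations preserving the zero set form a group; it suffices that it contains 1 and `τ`.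
  let G : AddSubgroup ℂ :=
    { carrier := {l | ∀ v, thetaD 0 τ (v + l) = 0 ↔ thetaD 0 τ v = 0}
      add_mem' := fun {a b} ha hb v => by rw [← add_assoc, hb, ha]
      zero_mem' := fun v => by rw [add_zero]
      neg_mem' := fun {a} ha v => by rw [← ha (v + -a), neg_add_cancel_right] }
  have hle : (periods τ).lattice ≤ AddSubgroup.toIntSubmodule G := by
    refine Submodule.span_le.mpr ?_
    rintro x (rfl | rfl) v
    · change thetaD 0 τ (v + 1) = 0 ↔ _
      rw [thetaD_zero_add_one, neg_eq_zero]
    · change thetaD 0 τ (v + τ) = 0 ↔ _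
      rw [thetaD_zero_add_tau', mul_eq_zero, or_iff_right (thetaMul_ne_zero _ _)]
  have := (hle hu) 0
  rw [zero_add] at this
  exact this.mpr (thetaD_zero_zero _)

open Classical in
/-- The entire extension of `θ₁² ℘`. -/
def thetaSqWp (u : ℂ) : ℂ :=
  thetaD 0 τ u ^ 2 * wp τ u + if u ∈ (periods τ).lattice then thetaD 1 τ u ^ 2 else 0

lemma thetaSqWp_of_mem {u : ℂ} (hu : u ∈ (periods τ).lattice) :
    thetaSqWp τ u = thetaD 1 τ u ^ 2 := by
  simp [thetaSqWp, hu, thetaD_zero_of_mem τ hu]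

lemma thetaSqWp_of_notMem {u : ℂ} (hu : u ∉ (periods τ).lattice) :
    thetaSqWp τ u = thetaD 0 τ u ^ 2 * wp τ u := by
  simp [thetaSqWp, hu]

/-- Near a lattice point `u`, ℘ is a regular function plus 1/(v-u)², and θ₁²/(v-u)² is the square of
the divided slope, with value θ₁'(u)² at `u`. At `u = 0` the term `1 / u ^ 2` is 0 by convention. -/
lemma differentiable_thetaSqWp : Differentiable ℂ (thetaSqWp τ) := by
  have h0 := differentiable_thetaD 0 τ.im_pos
  intro u
  by_cases hu : u ∈ (periods τ).lattice
  · have hev : thetaSqWp τ =ᶠ[𝓝 u] fun v => thetaD 0 τ v ^ 2 *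
        ((periods τ).weierstrassPExcept u v - 1 / u ^ 2) + dslope (thetaD 0 τ) u v ^ 2 := by
      filter_upwards [(periods τ).compl_lattice_sdiff_singleton_mem_nhds u] with v hv
      by_cases hvu : v = u
      · subst hvu
        rw [thetaSqWp_of_mem τ hu, thetaD_zero_of_mem τ hu, dslope_same,
          (hasDerivAt_thetaD 0 τ.im_pos v).deriv]
        ring
      · have hvn : v ∉ (periods τ).lattice := fun h => hv ⟨h, hvu⟩
        rw [thetaSqWp_of_notMem τ hvn, dslope_of_ne _ hvu, slope_def_field,
          thetaD_zero_of_mem τ hu, wp, ← (periods τ).weierstrassPExcept_add ⟨u, hu⟩ v]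
        simp only
        generalize v - u = d
        ring
    refine DifferentiableAt.congr_of_eventuallyEq ?_ hev
    have hE : DifferentiableAt ℂ ((periods τ).weierstrassPExcept u) u :=
      ((periods τ).differentiableOn_weierstrassPExcept u).differentiableAt
        ((periods τ).compl_lattice_sdiff_singleton_mem_nhds u)
    have hd : DifferentiableAt ℂ (dslope (thetaD 0 τ) u) u :=
      ((differentiableOn_dslope univ_mem).mpr h0.differentiableOn).differentiableAt univ_mem
    exact (((h0 u).pow 2).mul (hE.sub_const _)).add (hd.pow 2)
  · have hmem := (periods τ).isClosed_lattice.isOpen_compl.mem_nhds hu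
    have hev : thetaSqWp τ =ᶠ[𝓝 u] fun v => thetaD 0 τ v ^ 2 * wp τ v := by
      filter_upwards [hmem] with v hv
      exact thetaSqWp_of_notMem τ hv
    refine DifferentiableAt.congr_of_eventuallyEq ?_ hev
    exact ((h0 u).pow 2).mul ((periods τ).differentiableOn_weierstrassP.differentiableAt hmem)

lemma wp_add_of_mem {l : ℂ} (hl : l ∈ (periods τ).lattice) (u : ℂ) : wp τ (u + l) = wp τ u :=
  (periods τ).weierstrassP_add_coe u ⟨l, hl⟩

lemma thetaSqWp_mem : thetaSqWp τ ∈ theta2Space (τ : ℂ) := by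
  refine ⟨differentiable_thetaSqWp τ, fun u => ?_, fun u => ?_⟩
  · by_cases hu : u ∈ (periods τ).lattice
    · rw [thetaSqWp_of_mem τ hu, thetaSqWp_of_mem τ (add_mem hu (one_mem_lattice τ)),
        thetaD_one_add_one τ.im_pos, neg_sq]
    · have hu' : u + 1 ∉ (periods τ).lattice :=
        fun h => hu (by simpa using sub_mem h (one_mem_lattice τ))
      rw [thetaSqWp_of_notMem τ hu, thetaSqWp_of_notMem τ hu', thetaD_zero_add_one, neg_sq,
        wp_add_of_mem τ (one_mem_lattice τ)]
  · rw [← thetaMul_mul (τ : ℂ) u 0, add_zero, sub_zero]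
    by_cases hu : u ∈ (periods τ).lattice
    · rw [thetaSqWp_of_mem τ hu, thetaSqWp_of_mem τ (add_mem hu (tau_mem_lattice τ)),
        thetaD_one_add_tau τ.im_pos, thetaD_zero_of_mem τ hu]
      ring
    · have hu' : u + τ ∉ (periods τ).lattice :=
        fun h => hu (by simpa using sub_mem h (tau_mem_lattice τ))
      rw [thetaSqWp_of_notMem τ hu, thetaSqWp_of_notMem τ hu', thetaD_zero_add_tau',
        wp_add_of_mem τ (tau_mem_lattice τ)]
      ring

/-- `θ₁²` and `θ₁² ℘` span `theta2Space τ`. -/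
lemma exists_eq_of_mem_theta2Space {F : ℂ → ℂ} (hF : F ∈ theta2Space (τ : ℂ)) :
    ∃ a b : ℂ, ∀ u, F u = a * thetaD 0 τ u ^ 2 + b * thetaSqWp τ u := by
  obtain ⟨a, b, c, hne, h⟩ := exists_relation_of_mem_theta2Space hF (thetaProd_mem τ.im_pos 0)
    (thetaSqWp_mem τ)
  have h' : ∀ u, a * F u + b * thetaD 0 τ u ^ 2 + c * thetaSqWp τ u = 0 := fun u => by
    rw [← h u, thetaProd, add_zero, sub_zero, sq]
  -- If `a = 0`, then either ℘ is constant near 0, against its double pole, or the relation is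
  -- trivial.
  by_cases ha : a = 0
  · exfalso
    subst ha
    have hev : ∀ᶠ u in 𝓝[≠] (0 : ℂ), b + c * wp τ u = 0 := by
      have hm := nhdsWithin_le_nhds (s := {0}ᶜ)
        ((periods τ).compl_lattice_sdiff_singleton_mem_nhds 0)
      filter_upwards [eventually_thetaD_zero_ne_zero τ.im_pos 0, hm, self_mem_nhdsWithin]
        with u hu hu2 hu3
      have := h' u
      rw [thetaSqWp_of_notMem τ fun hu4 => hu2 ⟨hu4, hu3⟩] at this
      refine (mul_eq_zero.mp ?_).resolve_left (pow_ne_zero 2 hu)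
      linear_combination this
    by_cases hc : c = 0
    · subst hc
      have hb : b = 0 := by simpa using hev.exists
      simp [hb] at hne
    · have hord := (periods τ).order_weierstrassP 0 (zero_mem _)
      rw [meromorphicOrderAt_congr (f₂ := fun _ => -b / c) (by
        filter_upwards [hev] with u hu
        change wp τ u = _
        field_simp
        linear_combination hu)] at hord
      have := (analyticAt_const (𝕜 := ℂ) (v := -b / c) (x := (0 : ℂ))).meromorphicOrderAt_nonneg
      rw [hord] at this
      exact absurd this (by decide)
  · refine ⟨-b / a, -c / a, fun u => ?_⟩
    field_simp
    linear_combination h' u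

/-- Otherwise both spanning functions, hence all of `theta2Space`, would vanish at `a`. -/
lemma thetaSqWp_ne_zero {a : ℂ} (ha : thetaD 0 τ a = 0) : thetaSqWp τ a ≠ 0 := by
  intro h
  obtain ⟨y, hy⟩ := exists_thetaProd_ne_zero τ.im_pos a
  obtain ⟨b, c, hbc⟩ := exists_eq_of_mem_theta2Space τ (thetaProd_mem τ.im_pos y)
  exact hy (by rw [hbc, ha, h]; ring)

/-- The zeros of `θ₁(· | τ)` are exactly the points of the lattice. -/
lemma thetaD_zero_ne_zero {u : ℂ} (hu : u ∉ (periods τ).lattice) : thetaD 0 τ u ≠ 0 := by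
  intro h
  refine thetaSqWp_ne_zero τ h ?_
  rw [thetaSqWp_of_notMem τ hu, h]
  ring

lemma thetaD_one_zero_ne_zero : thetaD 1 τ 0 ≠ 0 := by
  intro h
  refine thetaSqWp_ne_zero τ (thetaD_zero_zero _) ?_
  rw [thetaSqWp_of_mem τ (zero_mem _), h]
  ring

/-- Expand the product in θ₁² and θ₁²℘ as functions of `u`: the value at 0 fixes the coefficient of
θ₁²℘, and the zero at `u = y` fixes the other. -/
lemma theta_mul_theta_eq_wp_sub {u y : ℂ} (hu : u ∉ (periods τ).lattice)
    (hy : y ∉ (periods τ).lattice) :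
    thetaD 0 τ (u + y) * thetaD 0 τ (u - y) * thetaD 1 τ 0 ^ 2 =
      thetaD 0 τ u ^ 2 * thetaD 0 τ y ^ 2 * (wp τ y - wp τ u) := by
  obtain ⟨a, b, h⟩ := exists_eq_of_mem_theta2Space τ (thetaProd_mem τ.im_pos y)
  have h0 := h 0
  have hy' := h y
  have hu' := h u
  rw [thetaSqWp_of_mem τ (zero_mem _), thetaProd, thetaD_zero_zero, zero_add, zero_sub,
    thetaD_zero_neg] at h0
  rw [thetaSqWp_of_notMem τ hy, thetaProd, sub_self, thetaD_zero_zero] at hy'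
  rw [thetaSqWp_of_notMem τ hu, thetaProd] at hu'
  have ha : a + b * wp τ y = 0 := by
    refine (mul_eq_zero.mp ?_).resolve_left (pow_ne_zero 2 (thetaD_zero_ne_zero τ hy))
    linear_combination -hy'
  rw [hu']
  linear_combination (thetaD 0 τ u ^ 2 * thetaD 1 τ 0 ^ 2) * ha -
    (thetaD 0 τ u ^ 2 * (wp τ u - wp τ y)) * h0

lemma hasDerivAt_wp {u : ℂ} (hu : u ∉ (periods τ).lattice) :
    HasDerivAt (wp τ) ((periods τ).derivWeierstrassP u) u := by
  have h := ((periods τ).differentiableOn_weierstrassP.differentiableAt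
    ((periods τ).isClosed_lattice.isOpen_compl.mem_nhds hu)).hasDerivAt
  rwa [(periods τ).deriv_weierstrassP] at h

/-- Differentiate `theta_mul_theta_eq_wp_sub` in its first variable on the diagonal, where both
sides vanish. -/
lemma derivWeierstrassP_mul_theta {u : ℂ} (hu : u ∉ (periods τ).lattice) :
    (periods τ).derivWeierstrassP u * thetaD 0 τ u ^ 4 =
      -(thetaD 1 τ 0 ^ 3 * thetaD 0 τ (u + u)) := by
  have hmem := (periods τ).isClosed_lattice.isOpen_compl.mem_nhds hu
  have hd := hasDerivAt_thetaD 0 τ.im_pos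
  have h1 := ((((hd (u + u)).comp_add_const u u).mul ((hd (u - u)).comp_sub_const u u)).mul_const
    (thetaD 1 τ 0 ^ 2))
  have h2 := (((hd u).pow 2).mul_const (thetaD 0 τ u ^ 2)).mul
    ((hasDerivAt_wp τ hu).const_sub (wp τ u))
  have h3 := h1.congr_of_eventuallyEq (f₁ := fun v => thetaD 0 τ v ^ 2 * thetaD 0 τ u ^ 2 *
      (wp τ u - wp τ v)) (by
    filter_upwards [hmem] with v hv
    exact (theta_mul_theta_eq_wp_sub τ hv hu).symm)
  have h4 := h3.unique h2
  simp only [sub_self, thetaD_zero_zero, zero_add, mul_zero, Pi.pow_apply] at h4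
  linear_combination h4

end Zeros

/-! ### Theta identities behind the kernel equations -/

section Identities

variable (τ : ℍ)

/-- Centred at (u+v)/2, all three products become members of `theta2Space`. In their relation,
evaluation at (u+v)/2 and (u-v)/2 kills one product each and gives the ratios of the coefficients.
-/
lemma theta_addition {u v : ℂ} (hu : u ∉ (periods τ).lattice) (hv : v ∉ (periods τ).lattice)
    (z : ℂ) :
    (thetaD 1 τ (z - u) * thetaD 0 τ (z - v) - thetaD 0 τ (z - u) * thetaD 1 τ (z - v)) *
        (thetaD 0 τ u * thetaD 0 τ v) +
      (thetaD 1 τ u * thetaD 0 τ v - thetaD 0 τ u * thetaD 1 τ v) *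
        (thetaD 0 τ (z - u) * thetaD 0 τ (z - v)) =
      -(thetaD 1 τ 0 * thetaD 0 τ (u - v) * thetaD 0 τ (z - u - v) * thetaD 0 τ z) := by
  have hu' := thetaD_zero_ne_zero τ hu
  have hv' := thetaD_zero_ne_zero τ hv
  obtain ⟨a, b, c, hne, h⟩ := exists_relation_of_mem_theta2Space
    (thetaProd₁_mem τ.im_pos ((u - v) / 2)) (thetaProd_mem τ.im_pos ((u - v) / 2))
    (thetaProd_mem τ.im_pos ((u + v) / 2))
  have hδ := h ((u - v) / 2)
  have hs := h ((u + v) / 2)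
  have hz := h (z - (u + v) / 2)
  simp only [thetaProd, thetaProd₁, sub_self, add_halves, thetaD_zero_zero] at hδ hs hz
  rw [show (u - v) / 2 + (u + v) / 2 = u by ring, show (u - v) / 2 - (u + v) / 2 = -v by ring,
    thetaD_zero_neg] at hδ
  rw [show (u + v) / 2 + (u - v) / 2 = u by ring, show (u + v) / 2 - (u - v) / 2 = v by ring] at hs
  rw [show z - (u + v) / 2 + (u - v) / 2 = z - v by ring,
    show z - (u + v) / 2 - (u - v) / 2 = z - u by ring,
    show z - (u + v) / 2 + (u + v) / 2 = z by ring,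
    show z - (u + v) / 2 - (u + v) / 2 = z - u - v by ring] at hz
  have ha : a ≠ 0 := by
    rintro rfl
    have hb : b = 0 := by simpa [hu', hv'] using hs
    subst hb
    have hc : c = 0 := by simpa [hu', hv'] using hδ
    simp [hc] at hne
  refine mul_left_cancel₀ ha ?_
  linear_combination (-(thetaD 0 τ u * thetaD 0 τ v)) * hz +
    (thetaD 0 τ (z - u) * thetaD 0 τ (z - v)) * hs - (thetaD 0 τ z * thetaD 0 τ (z - u - v)) * hδ

/-- The identity behind the heat equation for the kernel `x`, for `z - u ∉ Λ`. -/
lemma theta_heat_aux {a : ℂ} (ha : a ∉ (periods τ).lattice) (u : ℂ) :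
    thetaD 1 τ 0 * (-(thetaD 2 τ a * (thetaD 0 τ (u + a) * thetaD 0 τ u)) +
      2 * thetaD 1 τ a *
        (thetaD 1 τ (u + a) * thetaD 0 τ u - thetaD 0 τ (u + a) * thetaD 1 τ u) -
      thetaD 0 τ a * (thetaD 2 τ (u + a) * thetaD 0 τ u -
        2 * (thetaD 1 τ (u + a) * thetaD 1 τ u) + thetaD 0 τ (u + a) * thetaD 2 τ u)) +
      thetaD 3 τ 0 * (thetaD 0 τ a * (thetaD 0 τ (u + a) * thetaD 0 τ u)) = 0 := by
  have ha' := thetaD_zero_ne_zero τ ha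
  have h10 := thetaD_one_zero_ne_zero τ
  have hτ := τ.im_pos
  set y := a / 2 with hy
  -- The coefficients give `F` a double zero at `y`: those of `thetaProd₁` and `thetaProd₂` cancel
  -- the value, that of `thetaProd` the derivative.
  let F : ℂ → ℂ := (thetaD 3 τ 0 * thetaD 0 τ a - thetaD 1 τ 0 * thetaD 2 τ a) • thetaProd τ y +
    (2 * thetaD 1 τ 0 * thetaD 1 τ a) • thetaProd₁ τ y -
    (thetaD 1 τ 0 * thetaD 0 τ a) • thetaProd₂ τ y
  have hFmem : F ∈ theta2Space (τ : ℂ) :=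
    sub_mem (add_mem (Submodule.smul_mem _ _ (thetaProd_mem hτ y))
      (Submodule.smul_mem _ _ (thetaProd₁_mem hτ y))) (Submodule.smul_mem _ _ (thetaProd₂_mem hτ y))
  have hF : ∀ w, F w = (thetaD 3 τ 0 * thetaD 0 τ a - thetaD 1 τ 0 * thetaD 2 τ a) *
      (thetaD 0 τ (w + y) * thetaD 0 τ (w - y)) + (2 * thetaD 1 τ 0 * thetaD 1 τ a) *
      (thetaD 1 τ (w + y) * thetaD 0 τ (w - y) - thetaD 0 τ (w + y) * thetaD 1 τ (w - y)) -
      (thetaD 1 τ 0 * thetaD 0 τ a) * (thetaD 2 τ (w + y) * thetaD 0 τ (w - y) -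
      2 * (thetaD 1 τ (w + y) * thetaD 1 τ (w - y)) + thetaD 0 τ (w + y) * thetaD 2 τ (w - y)) :=
    fun w => rfl
  have hyy : y + y = a := by rw [hy]; ring
  have hFy : F y = 0 := by
    rw [hF, sub_self, hyy, thetaD_zero_zero, thetaD_two_zero hτ]
    ring
  have hp : ∀ k, HasDerivAt (fun w => thetaD k τ (w + y)) (thetaD (k + 1) τ a) y := fun k => by
    rw [← hyy]
    exact (hasDerivAt_thetaD k hτ (y + y)).comp_add_const y y
  have hm : ∀ k, HasDerivAt (fun w => thetaD k τ (w - y)) (thetaD (k + 1) τ 0) y := fun k => by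
    rw [← sub_self y]
    exact (hasDerivAt_thetaD k hτ (y - y)).comp_sub_const y y
  have hF' : HasDerivAt F 0 y := by
    have h := ((((hp 0).mul (hm 0)).const_mul
      (thetaD 3 τ 0 * thetaD 0 τ a - thetaD 1 τ 0 * thetaD 2 τ a)).add
      ((((hp 1).mul (hm 0)).sub ((hp 0).mul (hm 1))).const_mul
        (2 * thetaD 1 τ 0 * thetaD 1 τ a))).sub
      (((((hp 2).mul (hm 0)).sub (((hp 1).mul (hm 1)).const_mul 2)).add
        ((hp 0).mul (hm 2))).const_mul (thetaD 1 τ 0 * thetaD 0 τ a))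
    refine (h.congr_of_eventuallyEq (Eventually.of_forall hF)).congr_deriv ?_
    rw [sub_self, hyy, thetaD_zero_zero, thetaD_two_zero hτ]
    simp only [Nat.reduceAdd, zero_add]
    ring
  have hG' : HasDerivAt (thetaProd τ y) (thetaD 0 τ a * thetaD 1 τ 0) y := by
    have h := (hp 0).mul (hm 0)
    refine h.congr_deriv ?_
    rw [sub_self, hyy, thetaD_zero_zero]
    simp only [zero_add]
    ring
  -- At `y`, `thetaProd τ s` is nonzero, `thetaProd τ y` has a simple zero and `F` a double one. The
  -- relation among them therefore forces `F = 0`.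
  obtain ⟨s, hs⟩ := exists_thetaProd_ne_zero hτ y
  obtain ⟨b, c, d, hne, h⟩ := exists_relation_of_mem_theta2Space hFmem (thetaProd_mem hτ y)
    (thetaProd_mem hτ s)
  have hd : d = 0 := by
    have := h y
    rw [hFy, show thetaProd τ y y = 0 by rw [thetaProd, sub_self, thetaD_zero_zero, mul_zero]]
      at this
    simpa [hs] using this
  subst hd
  have hc : c = 0 := by
    have h1 := (hF'.const_mul b).add (hG'.const_mul c)
    have h2 : HasDerivAt (fun w => b * F w + c * thetaProd τ y w) 0 y := by
      have e : (fun w => b * F w + c * thetaProd τ y w) = fun _ => 0 :=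
        funext fun w => by simpa using h w
      rw [e]
      exact hasDerivAt_const _ _
    have := h1.unique h2
    simpa [ha', h10] using this
  subst hc
  have hb : b ≠ 0 := by simpa using hne
  have hfin := h (u + y)
  have hF0 : F (u + y) = 0 := by simpa [hb] using hfin
  rw [hF, add_sub_cancel_right, add_assoc, hyy] at hF0
  linear_combination hF0

/-- The identity behind the heat equation for the kernel `x`. -/
lemma theta_heat (u z : ℂ) :
    thetaD 1 τ 0 * (-(thetaD 2 τ (z - u) * (thetaD 0 τ z * thetaD 0 τ u)) +
      2 * thetaD 1 τ (z - u) *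
        (thetaD 1 τ z * thetaD 0 τ u - thetaD 0 τ z * thetaD 1 τ u) -
      thetaD 0 τ (z - u) * (thetaD 2 τ z * thetaD 0 τ u -
        2 * (thetaD 1 τ z * thetaD 1 τ u) + thetaD 0 τ z * thetaD 2 τ u)) +
      thetaD 3 τ 0 * (thetaD 0 τ (z - u) * (thetaD 0 τ z * thetaD 0 τ u)) = 0 := by
  have hc := fun k => (differentiable_thetaD k τ.im_pos).continuous
  have h0 := hc 0
  have h1 := hc 1
  have h2 := hc 2
  have ht : Tendsto (fun w => w - u) (𝓝[≠] z) (𝓝[≠] (z - u)) := by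
    refine tendsto_nhdsWithin_iff.mpr ⟨?_, ?_⟩
    · exact (Continuous.tendsto (by fun_prop) z).mono_left nhdsWithin_le_nhds
    · filter_upwards [self_mem_nhdsWithin] with w hw
      simpa using hw
  let G : ℂ → ℂ := fun w => thetaD 1 τ 0 * (-(thetaD 2 τ (w - u) *
      (thetaD 0 τ w * thetaD 0 τ u)) + 2 * thetaD 1 τ (w - u) *
        (thetaD 1 τ w * thetaD 0 τ u - thetaD 0 τ w * thetaD 1 τ u) -
      thetaD 0 τ (w - u) * (thetaD 2 τ w * thetaD 0 τ u -
        2 * (thetaD 1 τ w * thetaD 1 τ u) + thetaD 0 τ w * thetaD 2 τ u)) +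
      thetaD 3 τ 0 * (thetaD 0 τ (w - u) * (thetaD 0 τ w * thetaD 0 τ u))
  have hG : Continuous G := by fun_prop
  -- The case `z - u ∈ Λ` follows by continuity in `z`.
  refine tendsto_nhds_unique_of_eventuallyEq
    ((hG.tendsto z).mono_left (nhdsWithin_le_nhds (s := {z}ᶜ))) tendsto_const_nhds ?_
  filter_upwards [ht.eventually (eventually_thetaD_zero_ne_zero τ.im_pos (z - u))] with w hw
  have hw' : w - u ∉ (periods τ).lattice := fun h => hw (thetaD_zero_of_mem τ h)
  have := theta_heat_aux τ hw' u
  rwa [add_sub_cancel] at this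

end Identities

/-! ### Functional, heat and quasi-periodicity equations of `x` and `y` -/

section Kernels

lemma x_eq {τ : ℂ} (hτ : 0 < τ.im) (u z : ℂ) :
    x τ u z = thetaD 0 τ (z - u) * thetaD 1 τ 0 / (thetaD 0 τ z * thetaD 0 τ u) := by
  rw [x, deriv_theta1 hτ, theta1_eq_thetaD]

variable (τ : ℍ)

lemma y_eq {u : ℂ} (hu : u ∉ (periods τ).lattice) (z : ℂ) :
    y τ u z = -(thetaD 1 τ 0 * (thetaD 1 τ (z - u) * thetaD 0 τ u +
      thetaD 0 τ (z - u) * thetaD 1 τ u)) / (thetaD 0 τ z * thetaD 0 τ u ^ 2) := by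
  have hu' := thetaD_zero_ne_zero τ hu
  have hd := hasDerivAt_thetaD 0 τ.im_pos
  have h := ((((hd (z - u)).comp_const_sub z u).div (hd u) hu').const_mul
    (thetaD 1 τ 0 / thetaD 0 τ z))
  have e : (fun s => x τ s z) = fun s => thetaD 1 τ 0 / thetaD 0 τ z *
      ((fun s => thetaD 0 τ (z - s)) / thetaD 0 τ) s := by
    funext s
    rw [x_eq τ.im_pos, Pi.div_apply, div_mul_div_comm, mul_comm (thetaD 1 _ _)]
  rw [y, e, h.deriv, div_mul_div_comm]
  congr 1
  ring

/-- With ℘(u) - ℘(v) written through θ₁ and denominators cleared, this is θ₁'(0)² times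
`theta_addition`. -/
lemma x_mul_y_sub {u v z : ℂ} (hu : u ∉ (periods τ).lattice) (hv : v ∉ (periods τ).lattice)
    (huv : u + v ∉ (periods τ).lattice) (hz : z ∉ (periods τ).lattice) :
    x τ u z * y τ v z - y τ u z * x τ v z = x τ (u + v) z * (wp τ u - wp τ v) := by
  have hu' := thetaD_zero_ne_zero τ hu
  have hv' := thetaD_zero_ne_zero τ hv
  have huv' := thetaD_zero_ne_zero τ huv
  have hz' := thetaD_zero_ne_zero τ hz
  have h1 := theta_addition τ hu hv z
  have h2 : (wp τ v - wp τ u) = thetaD 0 τ (u + v) * thetaD 0 τ (u - v) * thetaD 1 τ 0 ^ 2 /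
      (thetaD 0 τ u ^ 2 * thetaD 0 τ v ^ 2) := by
    rw [theta_mul_theta_eq_wp_sub τ hu hv]
    field_simp
  rw [← neg_sub (wp τ v), h2, y_eq τ hu, y_eq τ hv, x_eq τ.im_pos, x_eq τ.im_pos, x_eq τ.im_pos,
    ← sub_sub]
  field_simp
  linear_combination (thetaD 1 τ 0) ^ 2 * h1

/-- The case `v = -u`, where `x (u + v)` has its pole; `theta_addition` still applies, and θ₁(2u)
yields ℘'. -/
lemma x_mul_y_neg_sub {u z : ℂ} (hu : u ∉ (periods τ).lattice) (hz : z ∉ (periods τ).lattice) :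
    x τ u z * y τ (-u) z - y τ u z * x τ (-u) z = (periods τ).derivWeierstrassP u := by
  have hu' := thetaD_zero_ne_zero τ hu
  have hz' := thetaD_zero_ne_zero τ hz
  have hn : -u ∉ (periods τ).lattice := fun h => hu (neg_mem_iff.mp h)
  have h1 := theta_addition τ hu hn z
  have h2 : (periods τ).derivWeierstrassP u = -(thetaD 1 τ 0 ^ 3 * thetaD 0 τ (u + u)) /
      thetaD 0 τ u ^ 4 := by
    rw [← derivWeierstrassP_mul_theta τ hu]
    field_simp
  rw [h2, y_eq τ hu, y_eq τ hn, x_eq τ.im_pos, x_eq τ.im_pos]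
  simp only [sub_neg_eq_add, sub_add_cancel, thetaD_zero_neg, thetaD_one_neg τ.im_pos] at h1 ⊢
  generalize thetaD 0 τ (u + u) = t at h1 ⊢
  field_simp
  linear_combination (thetaD 1 τ 0 ^ 2) * h1

/-- The derivative `∂y(u, z)/∂z`. -/
def yz (u z : ℂ) : ℂ :=
  -(thetaD 1 τ 0 * ((thetaD 2 τ (z - u) * thetaD 0 τ u + thetaD 1 τ (z - u) * thetaD 1 τ u) *
    thetaD 0 τ z - (thetaD 1 τ (z - u) * thetaD 0 τ u + thetaD 0 τ (z - u) * thetaD 1 τ u) *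
    thetaD 1 τ z)) / (thetaD 0 τ z ^ 2 * thetaD 0 τ u ^ 2)

lemma hasDerivAt_y {u z : ℂ} (hu : u ∉ (periods τ).lattice) (hz : z ∉ (periods τ).lattice) :
    HasDerivAt (fun w => y τ u w) (yz τ u z) z := by
  have hu' := thetaD_zero_ne_zero τ hu
  have hz' := thetaD_zero_ne_zero τ hz
  have hd := fun k => (hasDerivAt_thetaD k τ.im_pos (z - u)).comp_sub_const z u
  have h := ((((((hd 1).mul_const (thetaD 0 τ u)).add
    ((hd 0).mul_const (thetaD 1 τ u))).const_mul (thetaD 1 τ 0)).neg).div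
    ((hasDerivAt_thetaD 0 τ.im_pos z).mul_const (thetaD 0 τ u ^ 2))
    (mul_ne_zero hz' (pow_ne_zero 2 hu')))
  refine (h.congr_of_eventuallyEq (Eventually.of_forall fun w => y_eq τ hu w)).congr_deriv ?_
  simp only [yz, Pi.add_apply, Pi.neg_apply, zero_add, Nat.reduceAdd]
  field_simp
  ring

/-- The kernel `x` satisfies `2πi ∂x/∂τ + ∂²x/∂u∂z = 0`. -/
lemma hasDerivAt_x_comp {z : ℂ} {f : ℂ → ℂ} {f' : ℂ} (hf : HasDerivAt f f' τ)
    (hu : f τ ∉ (periods τ).lattice) (hz : z ∉ (periods τ).lattice) :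
    HasDerivAt (fun t => x t (f t) z)
      (y τ (f τ) z * f' - yz τ (f τ) z / (2 * Real.pi * I)) τ := by
  have hu' := thetaD_zero_ne_zero τ hu
  have hz' := thetaD_zero_ne_zero τ hz
  have hpi : (Real.pi : ℂ) ≠ 0 := by exact_mod_cast Real.pi_ne_zero
  have hτ := τ.im_pos
  have h1 := hasDerivAt_thetaD_comp 0 hτ (hf.const_sub z)
  have h2 := hasDerivAt_thetaD_comp 1 hτ (hasDerivAt_const (τ : ℂ) (0 : ℂ))
  have h3 := hasDerivAt_thetaD_comp 0 hτ (hasDerivAt_const (τ : ℂ) z)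
  have h4 := hasDerivAt_thetaD_comp 0 hτ hf
  have h := (h1.mul h2).div (h3.mul h4) (mul_ne_zero hz' hu')
  have hev : (fun t => x t (f t) z) =ᶠ[𝓝 (τ : ℂ)] fun t => thetaD 0 t (z - f t) * thetaD 1 t 0 /
      (thetaD 0 t z * thetaD 0 t (f t)) := by
    filter_upwards [(isOpen_lt continuous_const continuous_im).mem_nhds hτ] with t ht
    exact x_eq ht _ _
  refine (h.congr_of_eventuallyEq hev).congr_deriv ?_
  rw [y_eq τ hu, yz]
  -- The terms with `f'` match `y`; the explicit `τ`-derivatives, turned into `u`-derivatives by the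
  -- heat equation of θ₁, match `yz` by this identity.
  have key := theta_heat τ (f τ) z
  simp only [Pi.mul_apply, zero_add, Nat.reduceAdd, mul_zero, add_zero]
  field_simp
  linear_combination 2 * key

lemma x_add_one (u z : ℂ) : x τ u (z + 1) = x τ u z := by
  rw [x_eq τ.im_pos, x_eq τ.im_pos, add_sub_right_comm, thetaD_zero_add_one, thetaD_zero_add_one,
    neg_mul, neg_mul, neg_div_neg_eq]

lemma y_add_one (u z : ℂ) : y τ u (z + 1) = y τ u z := by
  simp only [y, x_add_one]

lemma thetaMul_sub (t u z : ℂ) :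
    thetaMul t (z - u) = exp (2 * Real.pi * I * u) * thetaMul t z := by
  rw [thetaMul, thetaMul, mul_neg, ← exp_add]
  congr 2
  ring

lemma x_add_tau (u z : ℂ) : x τ u (z + τ) = exp (2 * Real.pi * I * u) * x τ u z := by
  rw [x_eq τ.im_pos, x_eq τ.im_pos, add_sub_right_comm, thetaD_zero_add_tau',
    thetaD_zero_add_tau', thetaMul_sub, ← mul_div_assoc]
  refine ((mul_div_mul_left _ _ (thetaMul_ne_zero τ z)).symm.trans ?_).symm
  congr 1 <;> ring

/-- The extra `x` term is the `u`-derivative of the factor e^{2πiu} in `x_add_tau`. -/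
lemma y_add_tau {u : ℂ} (hu : u ∉ (periods τ).lattice) (z : ℂ) :
    y τ u (z + τ) = exp (2 * Real.pi * I * u) * (y τ u z + 2 * Real.pi * I * x τ u z) := by
  have hu' := thetaD_zero_ne_zero τ hu
  have e : x τ u z = thetaD 0 τ (z - u) * thetaD 1 τ 0 * thetaD 0 τ u /
      (thetaD 0 τ z * thetaD 0 τ u ^ 2) := by
    rw [x_eq τ.im_pos, ← mul_div_mul_right _ _ hu']
    congr 1
    ring
  rw [y_eq τ hu, y_eq τ hu, e, add_sub_right_comm, thetaD_zero_add_tau', thetaD_zero_add_tau',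
    thetaD_one_add_tau τ.im_pos, thetaMul_sub, ← mul_div_assoc, ← add_div, ← mul_div_assoc]
  refine ((mul_div_mul_left _ _ (thetaMul_ne_zero τ z)).symm.trans ?_).symm
  congr 1 <;> ring

end Kernels

/-! ### Partial derivatives of the Hamiltonian -/

section Hamiltonian

variable {ℓ : ℕ} (g : ℂ) (τ : ℍ) (q p : Fin ℓ → ℂ)

lemma wp_zero : wp τ 0 = 0 := (periods τ).weierstrassP_zero

lemma wp_neg (u : ℂ) : wp τ (-u) = wp τ u := (periods τ).weierstrassP_neg u

lemma sum_erase_wp (j : Fin ℓ) :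
    ∑ k ∈ Finset.univ.erase j, wp τ (q j - q k) = ∑ k, wp τ (q j - q k) :=
  Finset.sum_erase _ (by rw [sub_self, wp_zero])

lemma hasDerivAt_update (j a : Fin ℓ) (s : ℂ) :
    HasDerivAt (fun s => Function.update q j s a) (if a = j then 1 else 0) s := by
  by_cases h : a = j
  · subst h
    simpa using hasDerivAt_id' s
  · simpa [h] using hasDerivAt_const s (q a)

lemma dHdp_eq (j : Fin ℓ) : dHdp g τ q p j = p j := by
  have h : HasDerivAt (fun s => hamiltonian g τ q (Function.update p j s)) (p j) (p j) := by
    have h1 := ((HasDerivAt.fun_sum (u := Finset.univ)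
      fun a _ => (hasDerivAt_update p j a (p j)).pow 2).const_mul (1 / 2)).add_const
        (g ^ 2 / 2 * ∑ j, ∑ k ∈ Finset.univ.erase j, wp τ (q j - q k))
    refine h1.congr_deriv ?_
    simp
  exact h.deriv

/-- Each pair occurs twice and ℘' is odd, which absorbs the 1/2. The summand `k = j` is harmless
since `derivWeierstrassP` is 0 at 0. -/
lemma dHdq_eq (hq : NonColliding τ q) (j : Fin ℓ) :
    dHdq g τ q p j = g ^ 2 * ∑ k, (periods τ).derivWeierstrassP (q j - q k) := by
  have h : HasDerivAt (fun s => hamiltonian g τ (Function.update q j s) p)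
      (g ^ 2 * ∑ k, (periods τ).derivWeierstrassP (q j - q k)) (q j) := by
    have hterm : ∀ a, ∀ b ∈ Finset.univ.erase a, HasDerivAt
        (fun s => wp τ (Function.update q j s a - Function.update q j s b))
        ((periods τ).derivWeierstrassP (q a - q b) *
          ((if a = j then 1 else 0) - if b = j then 1 else 0)) (q j) := by
      intro a b hb
      have hw := hasDerivAt_wp τ (hq a b (Finset.ne_of_mem_erase hb).symm)
      have hu := (hasDerivAt_update q j a (q j)).sub (hasDerivAt_update q j b (q j))
      refine HasDerivAt.comp (h₂ := wp τ) (q j) ?_ hu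
      simpa only [Pi.sub_apply, Function.update_eq_self] using hw
    have h1 := ((HasDerivAt.fun_sum (u := Finset.univ)
      fun a _ => HasDerivAt.fun_sum (hterm a)).const_mul (g ^ 2 / 2)).const_add
        (1 / 2 * ∑ j, p j ^ 2)
    refine h1.congr_deriv ?_
    have hs : ∀ a, ∑ b ∈ Finset.univ.erase a, (periods τ).derivWeierstrassP (q a - q b) *
        ((if a = j then 1 else 0) - if b = j then 1 else 0) =
        (if a = j then ∑ b, (periods τ).derivWeierstrassP (q j - q b) else 0) +
          (periods τ).derivWeierstrassP (q j - q a) := by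
      intro a
      rw [Finset.sum_erase _ (by simp)]
      simp only [mul_sub, mul_ite, mul_one, mul_zero, Finset.sum_sub_distrib,
        Finset.sum_ite_eq', Finset.mem_univ, if_true]
      rw [← neg_sub (q j) (q a), (periods τ).derivWeierstrassP_neg, sub_neg_eq_add]
      congr 1
      split_ifs with h
      · rw [h]
      · simp
    simp only [hs, Finset.sum_add_distrib, Finset.sum_ite_eq', Finset.mem_univ, if_true]
    ring
  exact h.deriv

end Hamiltonian

/-! ### The commutator and the zero-curvature equation -/

section Lax

variable {ℓ : ℕ} (g : ℂ) (τ : ℍ) (q p : Fin ℓ → ℂ)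

lemma laxL_diag (t z : ℂ) (j : Fin ℓ) : laxL g t q p z j j = p j := by simp [laxL]

lemma laxL_of_ne (t z : ℂ) {j k : Fin ℓ} (h : j ≠ k) :
    laxL g t q p z j k = I * g * x t (q j - q k) z := by simp [laxL, h]

lemma laxM_diag (z : ℂ) (j : Fin ℓ) :
    laxM g τ q z j j = I * g * ∑ k, wp τ (q j - q k) := by
  rw [laxM, Matrix.of_apply, if_pos rfl, sum_erase_wp]

lemma laxM_of_ne (z : ℂ) {j k : Fin ℓ} (h : j ≠ k) :
    laxM g τ q z j k = I * g * y τ (q j - q k) z := by simp [laxM, h]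

lemma commutator_diag (hq : NonColliding τ q) {z : ℂ} (hz : z ∉ Lambda τ) (j : Fin ℓ) :
    (laxL g τ q p z * laxM g τ q z - laxM g τ q z * laxL g τ q p z) j j =
      -(g ^ 2 * ∑ k, (periods τ).derivWeierstrassP (q j - q k)) := by
  rw [Matrix.sub_apply, Matrix.mul_apply, Matrix.mul_apply, ← Finset.sum_sub_distrib,
    Finset.mul_sum, ← Finset.sum_neg_distrib]
  refine Finset.sum_congr rfl fun k _ => ?_
  by_cases h : j = k
  · subst h
    rw [sub_self, (periods τ).derivWeierstrassP_zero]
    ring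
  · rw [laxL_of_ne g q p _ _ h, laxM_of_ne g τ q _ h, laxL_of_ne g q p _ _ (Ne.symm h),
      laxM_of_ne g τ q _ (Ne.symm h), ← x_mul_y_neg_sub τ (hq j k h) hz, neg_sub]
    linear_combination (g ^ 2 * (x τ (q j - q k) z * y τ (q k - q j) z -
      y τ (q j - q k) z * x τ (q k - q j) z)) * I_sq

/-- By `x_mul_y_sub` the intermediate indices sum to a multiple of `X` times a difference of ℘-sums,
which the diagonal entries of `M` cancel; only the momenta remain. -/
lemma commutator_of_ne (hq : NonColliding τ q) {z : ℂ} (hz : z ∉ Lambda τ) {j k : Fin ℓ}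
    (h : j ≠ k) :
    (laxL g τ q p z * laxM g τ q z - laxM g τ q z * laxL g τ q p z) j k =
      I * g * ((p j - p k) * y τ (q j - q k) z) := by
  rw [Matrix.sub_apply, Matrix.mul_apply, Matrix.mul_apply, ← Finset.sum_sub_distrib]
  set X := x τ (q j - q k) z with hX
  set Y := y τ (q j - q k) z with hY
  -- One formula for all `l`, with corrections at `l = j` and `l = k`. The terms ±g²X℘(qⱼ - qₖ)
  -- remove its spurious values there, as `wp τ 0 = 0`.
  have hterm : ∀ l, laxL g τ q p z j l * laxM g τ q z l k - laxM g τ q z j l * laxL g τ q p z l k =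
      -(g ^ 2 * X) * (wp τ (q j - q l) - wp τ (q k - q l)) +
      (if l = j then p j * (I * g * Y) - I * g * (∑ m, wp τ (q j - q m)) * (I * g * X) -
        g ^ 2 * X * wp τ (q j - q k) else 0) +
      (if l = k then I * g * X * (I * g * ∑ m, wp τ (q k - q m)) - I * g * Y * p k +
        g ^ 2 * X * wp τ (q j - q k) else 0) := by
    intro l
    by_cases hj : l = j
    · subst hj
      rw [if_pos rfl, if_neg h, laxL_diag, laxM_diag, laxM_of_ne g τ q _ h,
        laxL_of_ne g q p _ _ h, sub_self, wp_zero, ← wp_neg τ (q k - q l), neg_sub]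
      ring
    · by_cases hk : l = k
      · subst hk
        rw [if_pos rfl, if_neg hj, laxL_diag, laxM_diag, laxM_of_ne g τ q _ h,
          laxL_of_ne g q p _ _ h, sub_self, wp_zero]
        ring
      · have e : q j - q l + (q l - q k) = q j - q k := by ring
        have hadd := x_mul_y_sub τ (hq j l (Ne.symm hj)) (hq l k hk)
          (by rw [e]; exact hq j k h) hz
        rw [e, ← wp_neg τ (q l - q k), neg_sub] at hadd
        rw [if_neg hj, if_neg hk, laxL_of_ne g q p _ _ (Ne.symm hj), laxM_of_ne g τ q _ hk,
          laxM_of_ne g τ q _ (Ne.symm hj), laxL_of_ne g q p _ _ hk]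
        linear_combination (-g ^ 2) * hadd + g ^ 2 * (x τ (q j - q l) z * y τ (q l - q k) z -
          y τ (q j - q l) z * x τ (q l - q k) z) * I_sq
  simp only [hterm, Finset.sum_add_distrib, ← Finset.mul_sum, Finset.sum_sub_distrib,
    Finset.sum_ite_eq', Finset.mem_univ, if_true]
  linear_combination (g ^ 2 * X * (∑ m, wp τ (q k - q m) - ∑ m, wp τ (q j - q m))) * I_sq

lemma hasDerivAt_matrix {A : ℂ → Matrix (Fin ℓ) (Fin ℓ) ℂ} {A' : Matrix (Fin ℓ) (Fin ℓ) ℂ} {t : ℂ}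
    (h : ∀ j k, HasDerivAt (fun s => A s j k) (A' j k) t) : HasDerivAt A A' t := by
  have h' : HasDerivAt (F := Fin ℓ → Fin ℓ → ℂ) A A' t :=
    hasDerivAt_pi.mpr fun j => hasDerivAt_pi.mpr fun k => h j k
  exact h'

lemma expQ_eq (c : ℂ) : expQ c q = Matrix.diagonal fun j => exp (c * q j) := by
  rw [expQ, ← Matrix.diagonal_smul, Matrix.exp_diagonal]
  congr 1
  funext j
  rw [Pi.coe_exp, ← Complex.exp_eq_exp_ℂ]
  rfl

lemma expQ_conj_apply (c : ℂ) (A : Matrix (Fin ℓ) (Fin ℓ) ℂ) (j k : Fin ℓ) :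
    (expQ c q * A * expQ (-c) q) j k = exp (c * (q j - q k)) * A j k := by
  rw [expQ_eq, expQ_eq, Matrix.mul_diagonal, Matrix.diagonal_mul, mul_right_comm, ← exp_add]
  congr 2
  ring

lemma laxL_add_one (z : ℂ) : laxL g τ q p (z + 1) = laxL g τ q p z := by
  simp only [laxL, x_add_one]

lemma laxM_add_one (z : ℂ) : laxM g τ q (z + 1) = laxM g τ q z := by
  simp only [laxM, y_add_one]

lemma laxL_add_tau (z : ℂ) : laxL g τ q p (z + τ) =
    expQ (2 * Real.pi * I) q * laxL g τ q p z * expQ (-(2 * Real.pi * I)) q := by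
  ext j k
  rw [expQ_conj_apply]
  by_cases h : j = k
  · subst h
    simp [laxL_diag]
  · rw [laxL_of_ne g q p _ _ h, laxL_of_ne g q p _ _ h, x_add_tau]
    ring

/-- Conjugation fixes the diagonal, so subtracting 2πiP undoes the diagonal part of 2πiL. -/
lemma laxM_add_tau (hq : NonColliding τ q) (z : ℂ) : laxM g τ q (z + τ) =
    expQ (2 * Real.pi * I) q *
      (laxM g τ q z + (2 * Real.pi * I : ℂ) • laxL g τ q p z) * expQ (-(2 * Real.pi * I)) q -
      (2 * Real.pi * I : ℂ) • Matrix.diagonal p := by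
  ext j k
  rw [Matrix.sub_apply, expQ_conj_apply, Matrix.add_apply, Matrix.smul_apply, Matrix.smul_apply,
    smul_eq_mul, smul_eq_mul]
  by_cases h : j = k
  · subst h
    simp [laxL_diag, laxM_diag]
  · rw [laxL_of_ne g q p _ _ h, laxM_of_ne g τ q _ h, laxM_of_ne g τ q _ h,
      y_add_tau τ (hq j k h), Matrix.diagonal_apply_ne _ h]
    ring

/-- The zero-curvature equation along a solution of the non-autonomous system. -/
lemma exists_lax_derivatives {U : Set ℂ} {q p : ℂ → Fin ℓ → ℂ} (hs : IsSolutionOn g U q p)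
    (hU : (τ : ℂ) ∈ U) {z : ℂ} (hz : z ∉ Lambda τ) :
    ∃ dL dM : Matrix (Fin ℓ) (Fin ℓ) ℂ,
      HasDerivAt (fun t : ℂ => laxL g t (q t) (p t) z) dL τ ∧
      HasDerivAt (fun w : ℂ => laxM g τ (q τ) w) dM z ∧
      (2 * Real.pi * I : ℂ) • dL + dM =
        laxL g τ (q τ) (p τ) z * laxM g τ (q τ) z - laxM g τ (q τ) z * laxL g τ (q τ) (p τ) z := by
  have hq := hs.nonColliding τ hU
  have hpi : (2 * Real.pi * I : ℂ) ≠ 0 := two_pi_I_ne_zero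
  have hq' := fun j => (hs.differentiableAt_q τ hU j).hasDerivAt
  -- The `yz` term of the first matrix comes from the heat equation and cancels the second matrix
  -- off the diagonal; the sums `Dⱼ` do not depend on `z`.
  refine ⟨Matrix.of fun j k => if j = k then deriv (fun t => p t j) τ else
      I * g * (y τ (q τ j - q τ k) z * (deriv (fun t => q t j) τ - deriv (fun t => q t k) τ) -
        yz τ (q τ j - q τ k) z / (2 * Real.pi * I)),
    Matrix.of fun j k => if j = k then 0 else I * g * yz τ (q τ j - q τ k) z,
    hasDerivAt_matrix fun j k => ?_, hasDerivAt_matrix fun j k => ?_, ?_⟩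
  · by_cases h : j = k
    · subst h
      simp only [laxL_diag, Matrix.of_apply, if_true]
      exact (hs.differentiableAt_p τ hU j).hasDerivAt
    · simp only [laxL_of_ne _ _ _ _ _ h, Matrix.of_apply, if_neg h]
      exact (hasDerivAt_x_comp τ ((hq' j).sub (hq' k)) (hq j k h) hz).const_mul (I * g)
  · by_cases h : j = k
    · subst h
      simp only [laxM_diag, Matrix.of_apply, if_true]
      exact hasDerivAt_const _ _
    · simp only [laxM_of_ne _ _ _ _ h, Matrix.of_apply, if_neg h]
      exact (hasDerivAt_y τ (hq j k h) hz).const_mul (I * g)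
  · ext j k
    by_cases h : j = k
    · subst h
      rw [commutator_diag g τ (q τ) (p τ) hq hz, ← dHdq_eq g τ (q τ) (p τ) hq,
        ← hs.eq_p τ hU j]
      simp
    · rw [commutator_of_ne g τ (q τ) (p τ) hq hz h, Matrix.add_apply, Matrix.smul_apply,
        Matrix.of_apply, Matrix.of_apply, if_neg h, if_neg h, smul_eq_mul]
      have hj := hs.eq_q τ hU j
      have hk := hs.eq_q τ hU k
      rw [dHdp_eq] at hj hk
      rw [← hj, ← hk]
      field_simp
      ring

end Lax

end EllipticCM

end

theorem mainTheorem2 (ℓ : ℕ) (g : ℂ) :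
    (∀ (U : Set ℂ) (q p : ℂ → Fin ℓ → ℂ), EllipticCM.IsSolutionOn g U q p →
      ∀ τ : UpperHalfPlane, (τ : ℂ) ∈ U → ∀ z : ℂ, z ∉ EllipticCM.Lambda τ →
        ∃ dL dM : Matrix (Fin ℓ) (Fin ℓ) ℂ,
          HasDerivAt (fun t : ℂ => EllipticCM.laxL g t (q t) (p t) z) dL τ ∧
          HasDerivAt (fun w : ℂ => EllipticCM.laxM g τ (q τ) w) dM z ∧
          (2 * Real.pi * Complex.I : ℂ) • dL + dM =
            EllipticCM.laxL g τ (q τ) (p τ) z * EllipticCM.laxM g τ (q τ) z -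
              EllipticCM.laxM g τ (q τ) z * EllipticCM.laxL g τ (q τ) (p τ) z) ∧
    (∀ (τ : UpperHalfPlane) (q p : Fin ℓ → ℂ), EllipticCM.NonColliding τ q →
      ∀ z : ℂ, z ∉ EllipticCM.Lambda τ →
        EllipticCM.laxL g τ q p (z + 1) = EllipticCM.laxL g τ q p z ∧
        EllipticCM.laxM g τ q (z + 1) = EllipticCM.laxM g τ q z ∧
        EllipticCM.laxL g τ q p (z + τ) =
          EllipticCM.expQ (2 * Real.pi * Complex.I) q * EllipticCM.laxL g τ q p z *
            EllipticCM.expQ (-(2 * Real.pi * Complex.I)) q ∧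
        EllipticCM.laxM g τ q (z + τ) =
          EllipticCM.expQ (2 * Real.pi * Complex.I) q *
              (EllipticCM.laxM g τ q z +
                (2 * Real.pi * Complex.I : ℂ) • EllipticCM.laxL g τ q p z) *
              EllipticCM.expQ (-(2 * Real.pi * Complex.I)) q -
            (2 * Real.pi * Complex.I : ℂ) • Matrix.diagonal p) := by
  refine ⟨fun U q p hs τ hU z hz => EllipticCM.exists_lax_derivatives g τ hs hU hz,
    fun τ q p hq z _ => ⟨EllipticCM.laxL_add_one g τ q p z, EllipticCM.laxM_add_one g τ q z,
      EllipticCM.laxL_add_tau g τ q p z, EllipticCM.laxM_add_tau g τ q p hq z⟩⟩
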